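/- Let $V$ be a real vector space of finite dimension $m\ge 1$ with a norm $\|\cdot\|$, let $\langle\cdot,\cdot\rangle_1$ be a nondegenerate symmetric bilinear form on $V$ of signature $(-,+,\dots,+)$ with a chosen time orientation, let $\Gamma\subseteq V$ be a co-compact lattice, and let $f\colon V\to(0,\infty)$ be a smooth $\Gamma$-invariant function. Let $\overline g:=f^2\langle\cdot,\cdot\rangle_1$ be the associated Lorentzian metric on $V$, which is the lift of a Lorentzian metric on the torus $V/\Gamma$ to its universal cover. Let $\mathfrak T$ be the set of all $v\in V\setminus\{0\}$ that are positively time-oriented and satisfy $\langle v,v\rangle_1\le 0$, and for $\varepsilon>0$ let $$\mathfrak T_\varepsilon:=\{v\in\mathfrak T \mid \operatorname{dist}(v,\partial\mathfrak T)\ge\varepsilon\|v\|\},$$ where $\operatorname{dist}$ is the distance with respect to $\|\cdot\|$. Let $d$ be the time separation (Lorentzian distance function) of $(V,\overline g)$: $d(x,y)$ is the supremum of the $\overline g$-arc lengths $\int_0^1\sqrt{-\overline g_{\gamma(t)}(\dot\gamma(t),\dot\gamma(t))}\,dt$ over all piecewise smooth future pointing causal curves $\gamma\colon[0,1]\to V$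 from $x$ to $y$, and $d(x,y)=0$ if there is no such curve. Then for every $\varepsilon>0$ there exists a constant $L=L(\varepsilon)<\infty$ such that $d$ is finite and $L$-Lipschitz on $$\{(x,y)\in V\times V \mid y-x\in\mathfrak T_\varepsilon\}.$$ -/

import Mathlib

open Set MeasureTheory
open scoped ContDiff NNReal

namespace LorentzTorus

variable {V : Type*} [NormedAddCommGroup V] [NormedSpace ℝ V]

/-- `B` is a nondegenerate symmetric bilinear form of signature `(-, +, …, +)`: it has an
orthonormal basis whose first vector is timelike and whose other vectors are spacelike. -/
def IsLorentzian (B : LinearMap.BilinForm ℝ V) : Prop :=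
  ∃ (n : ℕ) (e : Module.Basis (Fin (n + 1)) ℝ V), ∀ i j : Fin (n + 1),
    B (e i) (e j) = if i = j then (if i = 0 then -1 else 1) else 0

/-- The positively oriented causal vectors of the form `B`. The time orientation is the one
represented by the timelike vector `τ`: a causal vector `v` points to the future if and only if
it lies in the same half cone as `τ`, that is, `B v τ < 0`. -/
def futureCausal (B : LinearMap.BilinForm ℝ V) (τ : V) : Set V :=
  {v | v ≠ 0 ∧ B v v ≤ 0 ∧ B v τ < 0}

/-- The future causal vectors `v` whose distance to the boundary of the set of all future causal
vectors, measured in the norm of `V`, is at least `ε * ‖v‖`. -/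
def futureCausalEps (B : LinearMap.BilinForm ℝ V) (τ : V) (ε : ℝ) : Set V :=
  {v | v ∈ futureCausal B τ ∧ ε * ‖v‖ ≤ Metric.infDist v (frontier (futureCausal B τ))}

/-- The conformally flat metric `f ^ 2 * B`, a bilinear form on each tangent space of `V`. -/
noncomputable def conformalMetric (f : V → ℝ) (B : LinearMap.BilinForm ℝ V) :
    V → LinearMap.BilinForm ℝ V :=
  fun x => (f x) ^ 2 • B

/-- The restriction of `γ` to `[0, 1]` is a piecewise smooth future pointing causal curve from `x`
to `y` for the metric `g` and the time orientation given by the constant vector field `τ`.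
There is a partition `0 = t 0 < t 1 < ⋯ < t n = 1` such that `γ` is smooth on each closed
subinterval, with future pointing causal (one-sided, at the ends) tangent vectors. -/
def IsFutureCausalCurve (g : V → LinearMap.BilinForm ℝ V) (τ : V) (γ : ℝ → V) (x y : V) : Prop :=
  γ 0 = x ∧ γ 1 = y ∧
    ∃ (n : ℕ) (t : ℕ → ℝ), t 0 = 0 ∧ t n = 1 ∧ ∀ i < n, t i < t (i + 1) ∧
      ContDiffOn ℝ ∞ γ (Icc (t i) (t (i + 1))) ∧
      ∀ s ∈ Icc (t i) (t (i + 1)),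
        derivWithin γ (Icc (t i) (t (i + 1))) s ∈ futureCausal (g (γ s)) τ

/-- The Lorentzian arc length of `γ` on `[0, 1]`. For a piecewise smooth curve the derivative
exists off a finite set. -/
noncomputable def lorentzLength (g : V → LinearMap.BilinForm ℝ V) (γ : ℝ → V) : ENNReal :=
  ∫⁻ s in Icc (0 : ℝ) 1, ENNReal.ofReal (Real.sqrt (-(g (γ s) (deriv γ s) (deriv γ s))))

/-- The time separation (Lorentzian distance function): the supremum of the arc lengths of the
future pointing causal curves from `x` to `y`, and `0` if there is no such curve. -/
noncomputable def timeSeparation (g : V → LinearMap.BilinForm ℝ V) (τ : V) (x y : V) : ENNReal :=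
  ⨆ (γ : ℝ → V) (_ : IsFutureCausalCurve g τ γ x y), lorentzLength g γ

end LorentzTorus

/-! By periodicity `f` lies between positive constants `m` and `M` and is globally Lipschitz, while
the causal cones are those of `B`, hence constant. The vectors at relative distance `ε` from the
boundary lie in a convex cone `steep B τ c`, on which the Lorentzian norm dominates the height `-B v
τ`. The heart of the matter is that moving `y` back to `y - s • τ` costs at most `K * s`, with `K`
uniform over all steep pairs, however far apart (`exists_sub_smul_le`).

At bounded height this follows by deformation: the convex combination of a causal curve with a
straight causal segment is causal, and its length drops by a fraction linear in the combination
parameter. That fraction grows with the height, so for distant points only the last piece, from `z`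
to `y`, of an almost maximal curve is deformed. This piece has bounded height, but it must not be
nearly null.

Periodicity rules that out. The curve from `x` to `z` is long in proportion to its height, so some
block of fixed height is steep, and a lattice vector `k` can be cut out there at bounded cost, the
rest being translated by `-k` (`sub_lattice_le`). Spending `k` on the last piece turns it into `y -
z + k`, whose Lorentzian norm is at least of the order of the square root of its height. If that
piece were nearly null, the gain would exceed the cost and contradict almost maximality.

Time reversal treats the other endpoint. A pair `(x', y')` near `(x, y)` satisfies `x' ≤ x + s • τ ≤
y - s • τ ≤ y'` causally, with `s` proportional to the displacement. This gives a one-sided local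
bound with a uniform constant; chaining it in both directions along segments gives the Lipschitz
estimate. -/

namespace LorentzTorus

/-! ### Lorentzian linear algebra: reverse inequalities and steep cones. -/

section Algebra

variable {V : Type*} [NormedAddCommGroup V] [NormedSpace ℝ V]

/-- The height of `v` measured by the timelike vector `τ`. -/
def height (B : LinearMap.BilinForm ℝ V) (τ v : V) : ℝ := -(B v τ)

/-- The Lorentzian norm of a causal vector. -/
noncomputable def timeNorm (B : LinearMap.BilinForm ℝ V) (v : V) : ℝ := Real.sqrt (-(B v v))

variable {B : LinearMap.BilinForm ℝ V} {τ : V}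

theorem height_add (v w : V) : height B τ (v + w) = height B τ v + height B τ w := by
  simp [height]; ring

theorem height_sub (v w : V) : height B τ (v - w) = height B τ v - height B τ w := by
  simp [height]; ring

theorem height_smul (r : ℝ) (v : V) : height B τ (r • v) = r * height B τ v := by
  simp [height]

theorem timeNorm_nonneg (v : V) : 0 ≤ timeNorm B v := Real.sqrt_nonneg _

theorem timeNorm_smul {r : ℝ} (hr : 0 ≤ r) (v : V) :
    timeNorm B (r • v) = r * timeNorm B v := by
  have : -(B (r • v) (r • v)) = r ^ 2 * -(B v v) := by simp; ring
  rw [timeNorm, this, Real.sqrt_mul (sq_nonneg r), Real.sqrt_sq hr, timeNorm]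

theorem mem_futureCausal {v : V} : v ∈ futureCausal B τ ↔ B v v ≤ 0 ∧ 0 < height B τ v := by
  refine ⟨fun h => ⟨h.2.1, neg_pos.2 h.2.2⟩, fun h => ⟨?_, h.1, neg_pos.1 h.2⟩⟩
  rintro rfl
  simp [height] at h

theorem sq_timeNorm {v : V} (hv : v ∈ futureCausal B τ) : timeNorm B v ^ 2 = -(B v v) :=
  Real.sq_sqrt (neg_nonneg.2 hv.2.1)

theorem height_pos {v : V} (hv : v ∈ futureCausal B τ) : 0 < height B τ v :=
  (mem_futureCausal.1 hv).2

theorem smul_mem_futureCausal {r : ℝ} (hr : 0 < r) {v : V} (hv : v ∈ futureCausal B τ) :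
    r • v ∈ futureCausal B τ := by
  rw [mem_futureCausal] at hv ⊢
  rw [height_smul]
  refine ⟨?_, mul_pos hr hv.2⟩
  have : B (r • v) (r • v) = r ^ 2 * B v v := by simp; ring
  rw [this]
  exact mul_nonpos_of_nonneg_of_nonpos (sq_nonneg r) hv.1

theorem IsLorentzian.apply_eq {B : LinearMap.BilinForm ℝ V} {n : ℕ}
    {e : Module.Basis (Fin (n + 1)) ℝ V}
    (he : ∀ i j : Fin (n + 1), B (e i) (e j) = if i = j then (if i = 0 then -1 else 1) else 0)
    (u v : V) : B u v = -(e.repr u 0 * e.repr v 0) +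
      ∑ i : Fin n, e.repr u i.succ * e.repr v i.succ := by
  conv_lhs => rw [← e.sum_repr u, ← e.sum_repr v]
  simp only [map_sum, LinearMap.sum_apply, map_smul, LinearMap.smul_apply, he, smul_eq_mul,
    mul_ite, mul_zero, Finset.sum_ite_eq', Finset.mem_univ, if_true]
  rw [Fin.sum_univ_succ]
  simp [Fin.succ_ne_zero, mul_comm]

theorem IsLorentzian.comm (hB : IsLorentzian B) (u v : V) : B u v = B v u := by
  obtain ⟨n, e, he⟩ := hB
  rw [IsLorentzian.apply_eq he, IsLorentzian.apply_eq he]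
  simp only [mul_comm]

/-- Cauchy-Schwarz on the spatial coordinates: orthogonality makes the spatial product of `w` and
`u` equal to the product of their time coordinates, and the time coordinate of `u` dominates its
spatial part. -/
theorem IsLorentzian.pos_of_orthogonal (hB : IsLorentzian B) {u w : V} (hu : B u u < 0)
    (huw : B w u = 0) (hw : w ≠ 0) : 0 < B w w := by
  obtain ⟨n, e, he⟩ := hB
  rw [IsLorentzian.apply_eq he] at hu huw ⊢
  have cs := Finset.sum_mul_sq_le_sq_mul_sq Finset.univ (fun i : Fin n => e.repr w i.succ)
    (fun i : Fin n => e.repr u i.succ)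
  simp only [← sq] at hu ⊢
  set a := e.repr w 0
  set b := e.repr u 0
  set S := ∑ i : Fin n, e.repr w i.succ ^ 2 with hS
  set U := ∑ i : Fin n, e.repr u i.succ ^ 2
  have hab : ∑ i : Fin n, e.repr w i.succ * e.repr u i.succ = a * b := by linarith
  rw [hab] at cs
  have hU : 0 ≤ U := Finset.sum_nonneg fun i _ => sq_nonneg _
  have hS0 : 0 ≤ S := Finset.sum_nonneg fun i _ => sq_nonneg _
  have hb : 0 < b ^ 2 := by linarith
  by_contra! hcon
  have h1 : S * b ^ 2 ≤ S * U := by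
    calc S * b ^ 2 ≤ a ^ 2 * b ^ 2 := by gcongr; linarith
      _ = (a * b) ^ 2 := by ring
      _ ≤ S * U := cs
  have hSz : S = 0 := by
    rcases hS0.eq_or_lt with h | h
    · exact h.symm
    · have := le_of_mul_le_mul_left h1 h
      linarith
  have ha : a = 0 := by
    have : a ^ 2 * b ^ 2 ≤ 0 := by rw [← mul_pow]; simpa [hSz] using cs
    have : a ^ 2 ≤ 0 := by nlinarith
    nlinarith
  apply hw
  apply e.ext_elem
  intro i
  rw [map_zero, Finsupp.zero_apply]
  refine Fin.cases ha (fun j => ?_) i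
  have := (Finset.sum_eq_zero_iff_of_nonneg (fun i _ => sq_nonneg _)).1 (hS ▸ hSz) j
    (Finset.mem_univ j)
  simpa using this

theorem IsLorentzian.nonneg_of_orthogonal (hB : IsLorentzian B) {u w : V} (hu : B u u < 0)
    (huw : B w u = 0) : 0 ≤ B w w := by
  rcases eq_or_ne w 0 with rfl | hw
  · simp
  · exact (hB.pos_of_orthogonal hu huw hw).le

/-- The reverse Cauchy-Schwarz inequality, in squared form. -/
theorem IsLorentzian.mul_le_sq (hB : IsLorentzian B) {u : V} (hu : B u u < 0) (v : V) :
    B u u * B v v ≤ B u v ^ 2 := by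
  -- A multiple of the component of `v` orthogonal to `u`.
  have h := hB.nonneg_of_orthogonal (u := u) (w := B u u • v - B u v • u) hu
    (by simp [hB.comm v u]; ring)
  have h2 : B (B u u • v - B u v • u) (B u u • v - B u v • u)
      = B u u * (B u u * B v v - B u v ^ 2) := by
    simp [hB.comm v u]; ring
  rw [h2] at h
  nlinarith

theorem IsLorentzian.height_mul_le (hB : IsLorentzian B) (hτ : B τ τ < 0) (v : V) :
    -(B τ τ) * -(B v v) ≤ height B τ v ^ 2 := by
  have := hB.mul_le_sq hτ v
  rw [height, hB.comm v τ]
  linarith [neg_sq (B τ v)]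

/-- Two future causal vectors have nonpositive product. -/
theorem IsLorentzian.apply_nonpos (hB : IsLorentzian B) (hτ : B τ τ < 0) {u v : V}
    (hu : u ∈ futureCausal B τ) (hv : v ∈ futureCausal B τ) : B u v ≤ 0 := by
  rw [mem_futureCausal] at hu hv
  -- the combination of `u` and `v` orthogonal to `τ` is spacelike
  have h := hB.nonneg_of_orthogonal (u := τ) (w := height B τ v • u - height B τ u • v) hτ
    (by simp [height]; ring)
  have h2 : B (height B τ v • u - height B τ u • v) (height B τ v • u - height B τ u • v)
      = height B τ v ^ 2 * B u u + height B τ u ^ 2 * B v v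
        - 2 * (height B τ u * height B τ v) * B u v := by
    simp [hB.comm v u]; ring
  rw [h2] at h
  have h3 := mul_nonpos_of_nonneg_of_nonpos (sq_nonneg (height B τ v)) hu.1
  have h4 := mul_nonpos_of_nonneg_of_nonpos (sq_nonneg (height B τ u)) hv.1
  have h5 := mul_pos hu.2 hv.2
  nlinarith

/-- The reverse Cauchy-Schwarz inequality. -/
theorem IsLorentzian.timeNorm_mul_le (hB : IsLorentzian B) (hτ : B τ τ < 0) {u v : V}
    (hu : u ∈ futureCausal B τ) (hv : v ∈ futureCausal B τ) :
    timeNorm B u * timeNorm B v ≤ -(B u v) := by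
  have h0 := hB.apply_nonpos hτ hu hv
  refine abs_le_of_sq_le_sq' ?_ (by linarith) |>.2
  rw [mul_pow, sq_timeNorm hu, sq_timeNorm hv]
  rcases hu.2.1.eq_or_lt with h | h
  · rw [h]; simpa using sq_nonneg _
  · have := hB.mul_le_sq h v
    linarith [neg_sq (B u v)]

theorem IsLorentzian.add_mem (hB : IsLorentzian B) (hτ : B τ τ < 0) {u v : V}
    (hu : u ∈ futureCausal B τ) (hv : v ∈ futureCausal B τ) : u + v ∈ futureCausal B τ := by
  have h0 := hB.apply_nonpos hτ hu hv
  rw [mem_futureCausal] at *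
  rw [height_add]
  refine ⟨?_, add_pos hu.2 hv.2⟩
  simp only [map_add, LinearMap.add_apply, hB.comm v u]
  linarith [hu.1, hv.1]

theorem IsLorentzian.sq_timeNorm_add (hB : IsLorentzian B) (hτ : B τ τ < 0) {u v : V}
    (hu : u ∈ futureCausal B τ) (hv : v ∈ futureCausal B τ) :
    timeNorm B (u + v) ^ 2 = timeNorm B u ^ 2 + timeNorm B v ^ 2 + 2 * -(B u v) := by
  rw [sq_timeNorm (hB.add_mem hτ hu hv), sq_timeNorm hu, sq_timeNorm hv]
  simp only [map_add, LinearMap.add_apply, hB.comm v u]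
  ring

/-- The reverse triangle inequality. -/
theorem IsLorentzian.add_timeNorm_le (hB : IsLorentzian B) (hτ : B τ τ < 0) {u v : V}
    (hu : u ∈ futureCausal B τ) (hv : v ∈ futureCausal B τ) :
    timeNorm B u + timeNorm B v ≤ timeNorm B (u + v) := by
  refine abs_le_of_sq_le_sq' ?_ (timeNorm_nonneg _) |>.2
  rw [hB.sq_timeNorm_add hτ hu hv]
  linarith [hB.timeNorm_mul_le hτ hu hv, add_sq (timeNorm B u) (timeNorm B v)]

theorem self_mem_futureCausal (hτ : B τ τ < 0) : τ ∈ futureCausal B τ :=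
  mem_futureCausal.2 ⟨hτ.le, neg_pos.2 hτ⟩

theorem IsLorentzian.timeNorm_le_height (hB : IsLorentzian B) (hτ : B τ τ < 0) {v : V}
    (hv : v ∈ futureCausal B τ) : timeNorm B v * timeNorm B τ ≤ height B τ v :=
  hB.timeNorm_mul_le hτ hv (self_mem_futureCausal hτ)

theorem timeNorm_pos {v : V} (hv : B v v < 0) : 0 < timeNorm B v := Real.sqrt_pos.2 (neg_pos.2 hv)

/-- The future causal vectors whose slope with respect to `τ` is bounded away from the cone. -/
def steep (B : LinearMap.BilinForm ℝ V) (τ : V) (c : ℝ) : Set V :=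
  {v | v ∈ futureCausal B τ ∧ c * height B τ v ≤ timeNorm B v}

theorem IsLorentzian.steep_add (hB : IsLorentzian B) (hτ : B τ τ < 0) {c : ℝ} {u v : V}
    (hu : u ∈ steep B τ c) (hv : v ∈ steep B τ c) : u + v ∈ steep B τ c := by
  refine ⟨hB.add_mem hτ hu.1 hv.1, ?_⟩
  rw [height_add, mul_add]
  exact (add_le_add hu.2 hv.2).trans (hB.add_timeNorm_le hτ hu.1 hv.1)

theorem steep_smul {c r : ℝ} (hr : 0 < r) {v : V} (hv : v ∈ steep B τ c) :
    r • v ∈ steep B τ c := by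
  refine ⟨smul_mem_futureCausal hr hv.1, ?_⟩
  rw [height_smul, timeNorm_smul hr.le]
  nlinarith [hv.2]

/-- In `B (v - s • τ) (v - s • τ)` the term linear in `s` is absorbed by `-(B v v) ≥ c ^ 2 * height
^ 2`, and the quadratic term has the good sign. -/
theorem IsLorentzian.sub_smul_mem (hB : IsLorentzian B) (hτ : B τ τ < 0) {c s : ℝ} (hc : 0 < c)
    {v : V} (hv : v ∈ steep B τ c) (hsc : 2 * s ≤ c ^ 2 * height B τ v) :
    v - s • τ ∈ futureCausal B τ := by
  have hl := height_pos hv.1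
  have h1 : c ^ 2 * height B τ v ^ 2 ≤ -(B v v) := by
    rw [← sq_timeNorm hv.1, ← mul_pow]
    exact pow_le_pow_left₀ (by positivity) hv.2 2
  have h2 := hB.height_mul_le hτ v
  have hσ : 0 < -(B τ τ) := neg_pos.2 hτ
  rw [mem_futureCausal, height_sub, height_smul]
  constructor
  · have : B (v - s • τ) (v - s • τ) = B v v + 2 * s * height B τ v - s ^ 2 * -(B τ τ) := by
      simp [height, hB.comm τ v]; ring
    rw [this]
    nlinarith [mul_nonneg (sq_nonneg s) hσ.le, mul_le_mul_of_nonneg_right hsc hl.le]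
  · have h3 : c ^ 2 * -(B τ τ) ≤ 1 := by
      have : (c ^ 2 * -(B τ τ)) * height B τ v ^ 2 ≤ 1 * height B τ v ^ 2 := by
        nlinarith [mul_le_mul_of_nonneg_left h1 hσ.le]
      exact le_of_mul_le_mul_right this (by positivity)
    have : height B τ τ = -(B τ τ) := rfl
    rw [this]
    nlinarith [mul_le_mul_of_nonneg_right hsc hσ.le, mul_le_mul_of_nonneg_right h3 hl.le]

theorem IsLorentzian.sub_smul_mem_steep (hB : IsLorentzian B) (hτ : B τ τ < 0) {c s : ℝ}
    (hc : 0 < c) {v : V} (hv : v ∈ steep B τ c) (hs : 0 ≤ s)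
    (hsc : 4 * s ≤ c ^ 2 * height B τ v) : v - s • τ ∈ steep B τ (c / 2) := by
  have hl := height_pos hv.1
  have hm := hB.sub_smul_mem hτ (s := s) hc hv (by linarith)
  refine ⟨hm, ?_⟩
  have h1 : c ^ 2 * height B τ v ^ 2 ≤ -(B v v) := by
    rw [← sq_timeNorm hv.1, ← mul_pow]
    exact pow_le_pow_left₀ (by positivity) hv.2 2
  have hσ : 0 < -(B τ τ) := neg_pos.2 hτ
  have hle : height B τ (v - s • τ) ≤ height B τ v := by
    rw [height_sub, height_smul]
    have : 0 ≤ s * height B τ τ := mul_nonneg hs hσ.le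
    linarith
  refine (mul_le_mul_of_nonneg_left hle (by positivity)).trans
    (abs_le_of_sq_le_sq' ?_ (timeNorm_nonneg _)).2
  rw [sq_timeNorm hm]
  have : B (v - s • τ) (v - s • τ) = B v v + 2 * s * height B τ v - s ^ 2 * -(B τ τ) := by
    simp [height, hB.comm τ v]; ring
  rw [this]
  nlinarith [mul_nonneg (sq_nonneg s) hσ.le, mul_le_mul_of_nonneg_right hsc hl.le]

/-- The future cone contains its dual. -/
theorem IsLorentzian.mem_of_forall_apply_nonpos (hB : IsLorentzian B) (hτ : B τ τ < 0) {v : V}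
    (hv : 0 < height B τ v) (h : ∀ u ∈ futureCausal B τ, B v u ≤ 0) : v ∈ futureCausal B τ := by
  rw [mem_futureCausal]
  refine ⟨?_, hv⟩
  by_contra! hcon
  have hσ : 0 < -(B τ τ) := neg_pos.2 hτ
  set σ := -(B τ τ) with hσd
  set a := height B τ v with ha
  have hva : B v τ = -a := by simp [ha, height]
  have hva' : B τ v = -a := by rw [hB.comm, hva]
  have hττ : B τ τ = -σ := by simp [hσd]
  -- `ρ` is the square of the component of `v` orthogonal to `τ`; `b` makes `b • τ` plus that
  -- component a null vector, which serves as the test vector.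
  set ρ := B v v + a ^ 2 / σ with hρ
  have hρ0 : 0 < ρ := by positivity
  set b := Real.sqrt (ρ / σ)
  have hb : 0 < b := Real.sqrt_pos.2 (by positivity)
  have hb2 : b ^ 2 = ρ / σ := Real.sq_sqrt (by positivity)
  have hu : b • τ + (v - (a / σ) • τ) ∈ futureCausal B τ := by
    rw [mem_futureCausal]
    constructor
    · apply le_of_eq
      simp only [map_add, map_sub, map_smul, LinearMap.add_apply, LinearMap.sub_apply,
        LinearMap.smul_apply, smul_eq_mul, hva, hva', hττ]
      have : b ^ 2 * σ = B v v + a ^ 2 / σ := by rw [hb2]; field_simp; rw [hρ]; field_simp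
      field_simp at this ⊢
      linarith
    · have : height B τ (b • τ + (v - (a / σ) • τ)) = b * σ := by
        simp only [height, map_add, map_sub, map_smul, LinearMap.add_apply, LinearMap.sub_apply,
          LinearMap.smul_apply, smul_eq_mul, hva, hττ]
        field_simp
        ring
      rw [this]
      positivity
  have h1 := h _ hu
  have h2 : B v (b • τ + (v - (a / σ) • τ)) = ρ - a * b := by
    simp only [map_add, map_sub, map_smul, smul_eq_mul, hva, hρ]
    field_simp
    ring
  rw [h2] at h1
  have h3 : ρ ^ 2 ≤ a ^ 2 * (ρ / σ) := by
    rw [← hb2, ← mul_pow]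
    exact pow_le_pow_left₀ hρ0.le (by linarith) 2
  have h4 : ρ * (B v v) ≤ 0 := by
    have : ρ * B v v = ρ ^ 2 - a ^ 2 * (ρ / σ) := by rw [hρ]; field_simp; ring
    linarith
  linarith [mul_pos hρ0 hcon]

end Algebra

/-! ### Comparison with the norm and the lattice. -/

section Topology

variable {V : Type*} [NormedAddCommGroup V] [NormedSpace ℝ V] [FiniteDimensional ℝ V]
variable {B : LinearMap.BilinForm ℝ V} {τ : V}

theorem continuous_apply_self (B : LinearMap.BilinForm ℝ V) : Continuous fun v => B v v := by
  let B' : V →L[ℝ] V →L[ℝ] ℝ :=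
    LinearMap.toContinuousLinearMap
      ((LinearMap.toContinuousLinearMap : (V →ₗ[ℝ] ℝ) ≃ₗ[ℝ] V →L[ℝ] ℝ).toLinearMap ∘ₗ B)
  have : (fun v => B v v) = fun v => B' v v := rfl
  rw [this]
  fun_prop

theorem continuous_apply_left (B : LinearMap.BilinForm ℝ V) (u : V) :
    Continuous fun v => B v u :=
  LinearMap.continuous_of_finiteDimensional (B.flip u)

theorem continuous_height : Continuous (height B τ) := (continuous_apply_left B τ).neg

/-- The height is positive on the compact set of unit vectors of the closed cone, since nonzero
vectors orthogonal to `τ` are spacelike. -/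
theorem IsLorentzian.exists_norm_le (hB : IsLorentzian B) (hτ : B τ τ < 0) :
    ∃ C : ℝ, 0 < C ∧ ∀ v ∈ futureCausal B τ, ‖v‖ ≤ C * height B τ v := by
  let S : Set V := Metric.sphere 0 1 ∩ ({v | B v v ≤ 0} ∩ {v | 0 ≤ height B τ v})
  have hS : IsCompact S := (isCompact_sphere (0 : V) 1).inter_right
    ((isClosed_le (continuous_apply_self B) continuous_const).inter
      (isClosed_le continuous_const continuous_height))
  have key : ∃ c : ℝ, 0 < c ∧ ∀ v ∈ S, c ≤ height B τ v := by
    rcases S.eq_empty_or_nonempty with h | h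
    · exact ⟨1, one_pos, by simp [h]⟩
    · obtain ⟨v, hv, hmin⟩ := hS.exists_isMinOn h (continuous_height (B := B) (τ := τ)).continuousOn
      refine ⟨height B τ v, lt_of_le_of_ne hv.2.2 fun h0 => ?_, fun w hw => hmin hw⟩
      have hv0 : v ≠ 0 := by
        rintro rfl
        simpa using hv.1
      have := hB.pos_of_orthogonal hτ (by simpa [height] using h0.symm) hv0
      exact absurd hv.2.1 (not_le.2 this)
  obtain ⟨c, hc, hcS⟩ := key
  refine ⟨c⁻¹, inv_pos.2 hc, fun v hv => ?_⟩
  have hn : 0 < ‖v‖ := norm_pos_iff.2 hv.1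
  have hu := smul_mem_futureCausal (inv_pos.2 hn) hv
  have := hcS (‖v‖⁻¹ • v) ⟨by simp [norm_smul, hn.ne'], hu.2.1, (height_pos hu).le⟩
  rw [height_smul] at this
  rw [inv_mul_eq_div, le_div_iff₀ hc]
  rw [inv_mul_eq_div, le_div_iff₀ hn] at this
  linarith

/-- `τ` is interior to the cone; scale a ball around it. -/
theorem exists_add_smul_mem (hτ : B τ τ < 0) :
    ∃ A : ℝ, 0 < A ∧ ∀ (w : V) (s : ℝ), 0 < s → A * ‖w‖ ≤ s → w + s • τ ∈ futureCausal B τ := by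
  have hopen : IsOpen ({v | B v v < 0} ∩ {v | 0 < height B τ v}) :=
    (isOpen_lt (continuous_apply_self B) continuous_const).inter
      (isOpen_lt continuous_const continuous_height)
  obtain ⟨ρ, hρ, hball⟩ := Metric.isOpen_iff.1 hopen τ ⟨hτ, neg_pos.2 hτ⟩
  refine ⟨2 / ρ, by positivity, fun w s hs hws => ?_⟩
  have h1 : τ + s⁻¹ • w ∈ Metric.ball τ ρ := by
    rw [mem_ball_iff_norm, add_sub_cancel_left, norm_smul, norm_inv, Real.norm_of_nonneg hs.le,
      inv_mul_lt_iff₀ hs]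
    rw [div_mul_eq_mul_div, div_le_iff₀ hρ] at hws
    nlinarith
  have h2 := hball h1
  have h3 := smul_mem_futureCausal hs (mem_futureCausal.2 ⟨le_of_lt h2.1, h2.2⟩)
  rwa [smul_add, smul_inv_smul₀ hs.ne', add_comm] at h3

theorem IsPreconnected.inter_frontier_nonempty {X : Type*} [TopologicalSpace X] {s t : Set X}
    (hs : IsPreconnected s) (h : (s ∩ t).Nonempty) (h' : (s ∩ tᶜ).Nonempty) :
    (s ∩ frontier t).Nonempty := by
  by_contra hcon
  have hsub : ∀ p ∈ s, p ∈ closure t → p ∈ interior t := fun p hp hpc => by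
    by_contra hpi
    exact hcon ⟨p, hp, hpc, hpi⟩
  obtain ⟨p, hp, hpt⟩ := h
  obtain ⟨q, hq, hqt⟩ := h'
  obtain ⟨r, -, hr1, hr2⟩ := hs (interior t) (closure t)ᶜ isOpen_interior isClosed_closure.isOpen_compl
    (fun x hx => (em (x ∈ closure t)).imp (hsub x hx) id) ⟨p, hp, hsub p hp (subset_closure hpt)⟩
    ⟨q, hq, fun hqc => hqt (interior_subset (hsub q hq hqc))⟩
  exact hr2 (interior_subset_closure hr1)

/-- Such a `v` stays causal after subtracting a multiple of `τ` proportional to `‖v‖`; the reverse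
triangle inequality then bounds its Lorentzian norm below by a multiple of `‖v‖`, hence of the
height. -/
theorem IsLorentzian.exists_futureCausalEps_subset (hB : IsLorentzian B) (hτ : B τ τ < 0) {ε : ℝ}
    (hε : 0 < ε) : ∃ c : ℝ, 0 < c ∧ futureCausalEps B τ ε ⊆ steep B τ c := by
  have hτ0 : τ ≠ 0 := by rintro rfl; simp at hτ
  have hτn : 0 < ‖τ‖ := norm_pos_iff.2 hτ0
  have hNτ := timeNorm_pos hτ
  obtain ⟨Λ, hΛ, hbound⟩ : ∃ Λ : ℝ, 0 < Λ ∧ ∀ v, height B τ v ≤ Λ * ‖v‖ := by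
    let φ : V →L[ℝ] ℝ := LinearMap.toContinuousLinearMap (B.flip τ)
    refine ⟨‖φ‖ + 1, by positivity, fun v => ?_⟩
    calc height B τ v = -(φ v) := rfl
      _ ≤ ‖φ v‖ := neg_le_abs _
      _ ≤ ‖φ‖ * ‖v‖ := φ.le_opNorm v
      _ ≤ (‖φ‖ + 1) * ‖v‖ := by gcongr; linarith
  refine ⟨ε / (2 * ‖τ‖) * timeNorm B τ / Λ, by positivity, fun v hv => ⟨hv.1, ?_⟩⟩
  have hvn : 0 < ‖v‖ := norm_pos_iff.2 hv.1.1
  set s := ε * ‖v‖ / (2 * ‖τ‖) with hs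
  have hs0 : 0 < s := by positivity
  have hmem : v - s • τ ∈ futureCausal B τ := by
    by_contra hcon
    have hconn : IsPreconnected (Metric.closedBall v (ε * ‖v‖ / 2)) :=
      (convex_closedBall _ _).isPreconnected
    have hin : v - s • τ ∈ Metric.closedBall v (ε * ‖v‖ / 2) := by
      rw [mem_closedBall_iff_norm, sub_sub_cancel_left, norm_neg, norm_smul,
        Real.norm_of_nonneg hs0.le, hs]
      apply le_of_eq
      field_simp
    -- A connected ball of half the permitted radius that left the cone would meet its frontier too
    -- close to `v`.
    obtain ⟨p, hp, hpf⟩ := LorentzTorus.IsPreconnected.inter_frontier_nonempty hconn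
      ⟨v, Metric.mem_closedBall_self (by positivity), hv.1⟩ ⟨_, hin, hcon⟩
    have h1 := hv.2.trans (Metric.infDist_le_dist_of_mem hpf)
    have h2 := Metric.mem_closedBall.1 hp
    rw [dist_comm] at h2
    have : 0 < ε * ‖v‖ := by positivity
    linarith
  have h1 := hB.add_timeNorm_le hτ hmem (smul_mem_futureCausal hs0 (self_mem_futureCausal hτ))
  rw [sub_add_cancel, timeNorm_smul hs0.le] at h1
  have h2 := timeNorm_nonneg (B := B) (v - s • τ)
  calc ε / (2 * ‖τ‖) * timeNorm B τ / Λ * height B τ v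
      ≤ ε / (2 * ‖τ‖) * timeNorm B τ / Λ * (Λ * ‖v‖) := by gcongr; exact hbound v
    _ = s * timeNorm B τ := by rw [hs]; field_simp
    _ ≤ timeNorm B v := by linarith

theorem exists_lattice_norm_sub_le (Γ : Submodule ℤ V) [DiscreteTopology Γ] [IsZLattice ℝ Γ] :
    ∃ C : ℝ, ∀ x : V, ∃ k ∈ Γ, ‖x - k‖ ≤ C := by
  let b := (Module.Free.chooseBasis ℤ Γ).ofZLatticeBasis ℝ
  have hb : Submodule.span ℤ (Set.range b) = Γ :=
    (Module.Free.chooseBasis ℤ Γ).ofZLatticeBasis_span ℝ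
  refine ⟨∑ i, ‖b i‖, fun x => ⟨ZSpan.floor b x, hb.le (ZSpan.floor b x).2, ?_⟩⟩
  rw [← ZSpan.fract_apply]
  exact ZSpan.norm_fract_le b x

/-- There is a lattice vector `k` with `k - τ` future causal. -/
theorem exists_lattice_sub_mem (hτ : B τ τ < 0) (Γ : Submodule ℤ V) [DiscreteTopology Γ]
    [IsZLattice ℝ Γ] : ∃ k ∈ Γ, k - τ ∈ futureCausal B τ := by
  obtain ⟨A, hA, hAw⟩ := exists_add_smul_mem (V := V) hτ
  obtain ⟨C, hC⟩ := exists_lattice_norm_sub_le Γ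
  have hC0 : 0 ≤ C := by
    obtain ⟨k, -, hk⟩ := hC 0
    exact (norm_nonneg _).trans hk
  obtain ⟨k, hk, hkn⟩ := hC ((A * C + 2) • τ)
  refine ⟨k, hk, ?_⟩
  have := hAw (k - (A * C + 2) • τ) (A * C + 1) (by positivity) (by
    rw [norm_sub_rev]
    linarith [mul_le_mul_of_nonneg_left hkn hA.le])
  convert this using 1
  module

/-! ### Uniform bounds for periodic functions. -/

section Periodic

variable {Γ : Submodule ℤ V} [DiscreteTopology Γ] [IsZLattice ℝ Γ]

theorem exists_bounds_of_periodic {E : Type*} [NormedAddCommGroup E] {f : V → E}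
    (hf : Continuous f) (hfΓ : ∀ k ∈ Γ, ∀ x, f (x + k) = f x) :
    ∃ M : ℝ, 0 < M ∧ ∀ x, ‖f x‖ ≤ M := by
  obtain ⟨C, hC⟩ := exists_lattice_norm_sub_le Γ
  obtain ⟨M, hM⟩ := (isCompact_closedBall (0 : V) C).exists_bound_of_continuousOn hf.continuousOn
  refine ⟨|M| + 1, by positivity, fun x => ?_⟩
  obtain ⟨k, hk, hxk⟩ := hC x
  rw [← sub_add_cancel x k, hfΓ k hk]
  exact (hM _ (by simpa using hxk)).trans ((le_abs_self M).trans (by linarith))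

theorem exists_lower_bound_of_periodic {f : V → ℝ} (hf : Continuous f) (hfpos : ∀ x, 0 < f x)
    (hfΓ : ∀ k ∈ Γ, ∀ x, f (x + k) = f x) : ∃ m : ℝ, 0 < m ∧ ∀ x, m ≤ f x := by
  obtain ⟨M, hM, h⟩ := exists_bounds_of_periodic (Γ := Γ) (f := fun x => (f x)⁻¹)
    (hf.inv₀ fun x => (hfpos x).ne') (fun k hk x => by rw [hfΓ k hk])
  refine ⟨M⁻¹, inv_pos.2 hM, fun x => ?_⟩
  have := (le_abs_self _).trans (h x)
  exact (inv_le_comm₀ hM (hfpos x)).2 this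

theorem exists_lipschitz_of_periodic {f : V → ℝ} (hf : ContDiff ℝ ∞ f)
    (hfΓ : ∀ k ∈ Γ, ∀ x, f (x + k) = f x) :
    ∃ K : ℝ, 0 < K ∧ ∀ x y, |f x - f y| ≤ K * ‖x - y‖ := by
  obtain ⟨M, hM, h⟩ := exists_bounds_of_periodic (Γ := Γ) (f := fderiv ℝ f)
    (hf.continuous_fderiv (by simp)) (fun k hk x => by
      rw [← fderiv_comp_add_right]
      congr 1
      exact funext (hfΓ k hk))
  refine ⟨M, hM, fun x y => ?_⟩
  exact convex_univ.norm_image_sub_le_of_norm_fderiv_le (𝕜 := ℝ)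
    (fun z _ => (hf.differentiable (by simp)).differentiableAt) (fun z _ => h z) (mem_univ y)
    (mem_univ x)

end Periodic

end Topology

/-! ### Piecewise smooth causal curves and their lengths. -/

section Curves

variable {V : Type*} [NormedAddCommGroup V] [NormedSpace ℝ V]
variable {B : LinearMap.BilinForm ℝ V} {τ : V} {γ δ : ℝ → V} {a b c : ℝ} {f : V → ℝ}

/-- `γ` is smooth on `[a, b]` with future causal tangent vectors. -/
def IsSmoothCausalOn (B : LinearMap.BilinForm ℝ V) (τ : V) (γ : ℝ → V) (a b : ℝ) : Prop :=
  a < b ∧ ContDiffOn ℝ ∞ γ (Icc a b) ∧ ∀ s ∈ Icc a b, derivWithin γ (Icc a b) s ∈ futureCausal B τ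

/-- `γ` is piecewise smooth on `[a, b]` with future causal tangent vectors. -/
inductive IsCausalOn (B : LinearMap.BilinForm ℝ V) (τ : V) (γ : ℝ → V) : ℝ → ℝ → Prop
  | single {a b : ℝ} : IsSmoothCausalOn B τ γ a b → IsCausalOn B τ γ a b
  | step {a b c : ℝ} : IsCausalOn B τ γ a b → IsSmoothCausalOn B τ γ b c → IsCausalOn B τ γ a c

theorem IsSmoothCausalOn.hasDerivWithinAt (h : IsSmoothCausalOn B τ γ a b) {s : ℝ}
    (hs : s ∈ Icc a b) : HasDerivWithinAt γ (derivWithin γ (Icc a b) s) (Icc a b) s :=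
  ((h.2.1.differentiableOn (by simp)) s hs).hasDerivWithinAt

theorem IsSmoothCausalOn.continuousOn_derivWithin (h : IsSmoothCausalOn B τ γ a b) :
    ContinuousOn (derivWithin γ (Icc a b)) (Icc a b) :=
  h.2.1.continuousOn_derivWithin (uniqueDiffOn_Icc h.1) (by simp)

theorem IsSmoothCausalOn.of_hasDerivWithinAt {γ' : ℝ → V} (hab : a < b)
    (hγ : ContDiffOn ℝ ∞ γ (Icc a b))
    (h : ∀ s ∈ Icc a b, HasDerivWithinAt γ (γ' s) (Icc a b) s ∧ γ' s ∈ futureCausal B τ) :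
    IsSmoothCausalOn B τ γ a b :=
  ⟨hab, hγ, fun s hs => by
    rw [(h s hs).1.derivWithin (uniqueDiffOn_Icc hab s hs)]
    exact (h s hs).2⟩

theorem IsSmoothCausalOn.mono (h : IsSmoothCausalOn B τ γ a b) {a' b' : ℝ} (ha : a ≤ a')
    (hab : a' < b') (hb : b' ≤ b) : IsSmoothCausalOn B τ γ a' b' :=
  have hs := Icc_subset_Icc ha hb
  .of_hasDerivWithinAt hab (h.2.1.mono hs) fun s hs' =>
    ⟨(h.hasDerivWithinAt (hs hs')).mono hs, h.2.2 s (hs hs')⟩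

theorem IsSmoothCausalOn.congr (h : IsSmoothCausalOn B τ γ a b) (hδ : EqOn δ γ (Icc a b)) :
    IsSmoothCausalOn B τ δ a b :=
  .of_hasDerivWithinAt h.1 (h.2.1.congr hδ) fun s hs =>
    ⟨(h.hasDerivWithinAt hs).congr hδ (hδ hs), h.2.2 s hs⟩

theorem IsSmoothCausalOn.comp_affine (h : IsSmoothCausalOn B τ γ a b) {α : ℝ} (hα : 0 < α)
    (β : ℝ) : IsSmoothCausalOn B τ (fun s => γ (α * s + β)) ((a - β) / α) ((b - β) / α) := by
  have hmaps : MapsTo (fun s => α * s + β) (Icc ((a - β) / α) ((b - β) / α)) (Icc a b) := by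
    rintro s ⟨h1, h2⟩
    rw [div_le_iff₀ hα] at h1
    rw [le_div_iff₀ hα] at h2
    constructor <;> dsimp only <;> linarith
  refine .of_hasDerivWithinAt (γ' := fun s => α • derivWithin γ (Icc a b) (α * s + β))
    (by have := h.1; gcongr) (h.2.1.comp (by fun_prop) hmaps) fun s hs => ⟨?_, ?_⟩
  · have h1 : HasDerivWithinAt (fun s : ℝ => α * s + β) α (Icc ((a - β) / α) ((b - β) / α)) s := by
      simpa using (((hasDerivAt_id s).const_mul α).add_const β).hasDerivWithinAt
    exact (h.hasDerivWithinAt (hmaps hs)).scomp s h1 hmaps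
  · exact smul_mem_futureCausal hα (h.2.2 _ (hmaps hs))

/-- Covers both lattice translations (`μ = 1`, `q = 0`) and convex combinations with a straight
segment. -/
theorem IsSmoothCausalOn.smul_add (h : IsSmoothCausalOn B τ γ a b) {μ : ℝ} {p q : V}
    (hq : ∀ v ∈ futureCausal B τ, μ • v + q ∈ futureCausal B τ) :
    IsSmoothCausalOn B τ (fun s => μ • γ s + (p + s • q)) a b := by
  refine .of_hasDerivWithinAt (γ' := fun s => μ • derivWithin γ (Icc a b) s + q) h.1
    ((h.2.1.const_smul μ).add (by fun_prop)) fun s hs => ⟨?_, hq _ (h.2.2 s hs)⟩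
  have h1 : HasDerivWithinAt (fun s : ℝ => p + s • q) q (Icc a b) s := by
    simpa using (((hasDerivAt_id s).smul_const q).const_add p).hasDerivWithinAt
  exact ((h.hasDerivWithinAt hs).const_smul μ).add h1

theorem IsCausalOn.lt (h : IsCausalOn B τ γ a b) : a < b := by
  induction h with
  | single h => exact h.1
  | step _ h' ih => exact ih.trans h'.1

theorem IsCausalOn.mono (h : IsCausalOn B τ γ a b) {a' b' : ℝ} (ha : a ≤ a')
    (hab : a' < b') (hb : b' ≤ b) : IsCausalOn B τ γ a' b' := by
  induction h generalizing a' b' with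
  | single h => exact .single (h.mono ha hab hb)
  | @step b c h h' ih =>
    rcases le_or_gt b' b with h1 | h1
    · exact ih ha hab h1
    rcases le_or_gt b a' with h2 | h2
    · exact .single (h'.mono h2 hab hb)
    · exact (ih ha h2 le_rfl).step (h'.mono le_rfl h1 hb)

theorem IsCausalOn.trans (h : IsCausalOn B τ γ a b) (h' : IsCausalOn B τ γ b c) :
    IsCausalOn B τ γ a c := by
  induction h' with
  | single h' => exact h.step h'
  | step _ h' ih => exact ih.step h'

theorem IsCausalOn.congr (h : IsCausalOn B τ γ a b) (hδ : EqOn δ γ (Icc a b)) :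
    IsCausalOn B τ δ a b := by
  induction h with
  | single h => exact .single (h.congr hδ)
  | step h h' ih =>
    exact (ih (hδ.mono (Icc_subset_Icc_right h'.1.le))).step
      (h'.congr (hδ.mono (Icc_subset_Icc_left h.lt.le)))

theorem IsCausalOn.comp_affine (h : IsCausalOn B τ γ a b) {α : ℝ} (hα : 0 < α) (β : ℝ) :
    IsCausalOn B τ (fun s => γ (α * s + β)) ((a - β) / α) ((b - β) / α) := by
  induction h with
  | single h => exact .single (h.comp_affine hα β)
  | step _ h' ih => exact ih.step (h'.comp_affine hα β)

theorem IsCausalOn.smul_add (h : IsCausalOn B τ γ a b) {μ : ℝ} {p q : V}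
    (hq : ∀ v ∈ futureCausal B τ, μ • v + q ∈ futureCausal B τ) :
    IsCausalOn B τ (fun s => μ • γ s + (p + s • q)) a b := by
  induction h with
  | single h => exact .single (h.smul_add hq)
  | step _ h' ih => exact ih.step (h'.smul_add hq)

theorem isCausalOn_line {v : V} (hv : v ∈ futureCausal B τ) (x : V) :
    IsCausalOn B τ (fun s => x + s • v) 0 1 := by
  refine .single (.of_hasDerivWithinAt (γ' := fun _ => v) one_pos (by fun_prop)
    fun s _ => ⟨?_, hv⟩)
  simpa using (((hasDerivAt_id s).smul_const v).const_add x).hasDerivWithinAt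

theorem IsCausalOn.continuousOn (h : IsCausalOn B τ γ a b) : ContinuousOn γ (Icc a b) := by
  induction h with
  | single h => exact h.2.1.continuousOn
  | step h h' ih =>
    rw [← Icc_union_Icc_eq_Icc h.lt.le h'.1.le]
    exact ih.union_of_isClosed h'.2.1.continuousOn isClosed_Icc isClosed_Icc

theorem ae_restrict_Icc_of_forall_Ioo {p : ℝ → Prop} (h : ∀ s ∈ Ioo a b, p s) :
    ∀ᵐ s ∂volume.restrict (Icc a b), p s := by
  rw [← restrict_Ioo_eq_restrict_Icc]
  exact ae_restrict_of_forall_mem measurableSet_Ioo h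

theorem IsCausalOn.ae_deriv (h : IsCausalOn B τ γ a b) :
    ∀ᵐ s ∂volume.restrict (Icc a b), DifferentiableAt ℝ γ s ∧ deriv γ s ∈ futureCausal B τ := by
  have key : ∀ {a b : ℝ}, IsSmoothCausalOn B τ γ a b →
      ∀ᵐ s ∂volume.restrict (Icc a b), DifferentiableAt ℝ γ s ∧ deriv γ s ∈ futureCausal B τ := by
    refine fun h => ae_restrict_Icc_of_forall_Ioo fun s hs => ?_
    have h1 := (h.hasDerivWithinAt (Ioo_subset_Icc_self hs)).hasDerivAt (Icc_mem_nhds hs.1 hs.2)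
    refine ⟨h1.differentiableAt, ?_⟩
    rw [h1.deriv]
    exact h.2.2 s (Ioo_subset_Icc_self hs)
  induction h with
  | single h => exact key h
  | step h h' ih =>
    rw [← Icc_union_Icc_eq_Icc h.lt.le h'.1.le, ae_restrict_union_iff]
    exact ⟨ih, key h'⟩

/-- The length of the restriction of `γ` to `[a, b]` for the metric `f ^ 2 * B`. -/
noncomputable def curveLength (B : LinearMap.BilinForm ℝ V) (f : V → ℝ) (γ : ℝ → V) (a b : ℝ) :
    ENNReal :=
  ∫⁻ s in Icc a b, ENNReal.ofReal (f (γ s) * timeNorm B (deriv γ s))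

theorem curveLength_add (hab : a ≤ b) (hbc : b ≤ c) :
    curveLength B f γ a c = curveLength B f γ a b + curveLength B f γ b c := by
  unfold curveLength
  rw [← Icc_union_Ioc_eq_Icc hab hbc, lintegral_union measurableSet_Ioc, restrict_Ioc_eq_restrict_Icc]
  exact disjoint_left.2 fun s hs hs' => absurd hs.2 (not_le.2 hs'.1)

theorem curveLength_congr (h : EqOn δ γ (Icc a b)) :
    curveLength B f δ a b = curveLength B f γ a b := by
  refine lintegral_congr_ae (ae_restrict_Icc_of_forall_Ioo fun s hs => ?_)
  have : δ =ᶠ[nhds s] γ := Filter.eventually_of_mem (Icc_mem_nhds hs.1 hs.2) h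
  simp only [this.deriv_eq, h (Ioo_subset_Icc_self hs)]

theorem curveLength_comp_affine {α : ℝ} (hα : 0 < α) (β : ℝ) :
    curveLength B f (fun s => γ (α * s + β)) ((a - β) / α) ((b - β) / α) =
      curveLength B f γ a b := by
  unfold curveLength
  have himg : (fun s => α * s + β) '' Icc ((a - β) / α) ((b - β) / α) = Icc a b := by
    rw [image_affine_Icc' hα]
    congr 1 <;> field_simp <;> ring
  rw [← himg, lintegral_image_eq_lintegral_abs_deriv_mul measurableSet_Icc (f' := fun _ => α)]
  · refine lintegral_congr fun s => ?_
    have hd : deriv (fun s => γ (α * s + β)) s = α • deriv γ (α * s + β) := by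
      rw [deriv_comp_mul_left (f := fun t => γ (t + β)), deriv_comp_add_const]
    rw [hd, timeNorm_smul hα.le, abs_of_pos hα, ← ENNReal.ofReal_mul hα.le]
    congr 1
    ring
  · intro s _
    simpa using (((hasDerivAt_id s).const_mul α).add_const β).hasDerivWithinAt
  · intro s _ t _ hst
    simpa [hα.ne'] using hst

end Curves

/-! ### Integral estimates along causal curves. -/

section Estimates

variable {V : Type*} [NormedAddCommGroup V] [NormedSpace ℝ V] [FiniteDimensional ℝ V]
variable {B : LinearMap.BilinForm ℝ V} {τ : V} {γ δ : ℝ → V} {a b c : ℝ} {f : V → ℝ}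

theorem IsSmoothCausalOn.integral_eq (h : IsSmoothCausalOn B τ γ a b) (ψ : V →L[ℝ] ℝ) :
    ∫ s in a..b, ψ (derivWithin γ (Icc a b) s) = ψ (γ b - γ a) := by
  rw [ContinuousLinearMap.intervalIntegral_comp_comm,
    intervalIntegral.integral_derivWithin_Icc_of_contDiffOn_Icc (h.2.1.of_le (by simp)) h.1.le]
  exact ContinuousOn.intervalIntegrable_of_Icc h.1.le h.continuousOn_derivWithin

/-- Integrating `B γ' u ≤ 0` against every causal `u` puts the displacement in the dual cone. -/
theorem IsSmoothCausalOn.sub_mem (hB : IsLorentzian B) (hτ : B τ τ < 0)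
    (h : IsSmoothCausalOn B τ γ a b) : γ b - γ a ∈ futureCausal B τ := by
  have hc := h.continuousOn_derivWithin
  refine hB.mem_of_forall_apply_nonpos hτ ?_ fun u hu => ?_
  · let ψ : V →L[ℝ] ℝ := LinearMap.toContinuousLinearMap (-(B.flip τ))
    have h1 := h.integral_eq ψ
    have h2 : 0 < ∫ s in a..b, ψ (derivWithin γ (Icc a b) s) :=
      intervalIntegral.intervalIntegral_pos_of_pos_on
        (ContinuousOn.intervalIntegrable_of_Icc h.1.le (ψ.continuous.comp_continuousOn hc))
        (fun s hs => height_pos (B := B) (τ := τ) (h.2.2 s (Ioo_subset_Icc_self hs))) h.1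
    rw [h1] at h2
    exact h2
  · let ψ : V →L[ℝ] ℝ := LinearMap.toContinuousLinearMap (-(B.flip u))
    have h1 := h.integral_eq ψ
    have h2 : 0 ≤ ∫ s in a..b, ψ (derivWithin γ (Icc a b) s) :=
      intervalIntegral.integral_nonneg h.1.le fun s hs =>
        neg_nonneg.2 (hB.apply_nonpos hτ (h.2.2 s hs) hu)
    rw [h1] at h2
    exact neg_nonneg.1 h2

theorem IsCausalOn.sub_mem (hB : IsLorentzian B) (hτ : B τ τ < 0)
    (h : IsCausalOn B τ γ a b) : γ b - γ a ∈ futureCausal B τ := by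
  induction h with
  | single h => exact h.sub_mem hB hτ
  | step h h' ih =>
    rw [← sub_add_sub_cancel']
    exact hB.add_mem hτ ih (h'.sub_mem hB hτ)

/-- A calibration argument: `ψ` dominates the length integrand, and the integral of `ψ γ'` depends
only on the endpoints. -/
theorem IsCausalOn.curveLength_le (hB : IsLorentzian B) (hτ : B τ τ < 0) (hf : ∀ x, 0 < f x)
    (h : IsCausalOn B τ γ a b) (ψ : V →L[ℝ] ℝ)
    (hψ : ∀ x, ∀ v ∈ futureCausal B τ, f x * timeNorm B v ≤ ψ v) :
    curveLength B f γ a b ≤ ENNReal.ofReal (ψ (γ b - γ a)) := by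
  have hψ0 : ∀ v ∈ futureCausal B τ, 0 ≤ ψ v := fun v hv =>
    (mul_nonneg (hf 0).le (timeNorm_nonneg v)).trans (hψ 0 v hv)
  have key : ∀ {a b : ℝ}, IsSmoothCausalOn B τ γ a b →
      curveLength B f γ a b ≤ ENNReal.ofReal (ψ (γ b - γ a)) := by
    intro a b h
    have hc : ContinuousOn (fun s => ψ (derivWithin γ (Icc a b) s)) (Icc a b) :=
      ψ.continuous.comp_continuousOn h.continuousOn_derivWithin
    rw [← h.integral_eq ψ, intervalIntegral.integral_of_le h.1.le, ← integral_Icc_eq_integral_Ioc,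
      ofReal_integral_eq_lintegral_ofReal (hc.integrableOn_Icc)
        (ae_restrict_of_forall_mem measurableSet_Icc fun s hs => hψ0 _ (h.2.2 s hs))]
    refine lintegral_mono_ae (ae_restrict_Icc_of_forall_Ioo fun s hs => ?_)
    rw [← derivWithin_of_mem_nhds (Icc_mem_nhds hs.1 hs.2)]
    exact ENNReal.ofReal_le_ofReal (hψ _ _ (h.2.2 s (Ioo_subset_Icc_self hs)))
  induction h with
  | single h => exact key h
  | step h h' ih =>
    rw [curveLength_add h.lt.le h'.1.le, ← sub_add_sub_cancel', map_add,
      ENNReal.ofReal_add (hψ0 _ (h.sub_mem hB hτ)) (hψ0 _ (h'.sub_mem hB hτ))]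
    exact add_le_add ih (key h')

end Estimates

/-! ### Basic properties of the time separation. -/

section TimeSeparation

variable {V : Type*} [NormedAddCommGroup V] [NormedSpace ℝ V]
variable {B : LinearMap.BilinForm ℝ V} {τ : V} {γ δ : ℝ → V} {a b c : ℝ} {f : V → ℝ}

theorem futureCausal_conformalMetric (hf : ∀ x, 0 < f x) (x : V) :
    futureCausal (conformalMetric f B x) τ = futureCausal B τ := by
  have h : 0 < f x ^ 2 := pow_pos (hf x) 2
  ext v
  simp only [futureCausal, conformalMetric, mem_ofPred_eq, LinearMap.smul_apply, smul_eq_mul,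
    mul_neg_iff, h, not_lt_of_gt h, mul_nonpos_iff, h.le, not_le_of_gt h, true_and, false_and,
    or_false]

theorem lorentzLength_conformalMetric (hf : ∀ x, 0 < f x) (γ : ℝ → V) :
    lorentzLength (conformalMetric f B) γ = curveLength B f γ 0 1 := by
  refine lintegral_congr fun s => ?_
  have : -(conformalMetric f B (γ s) (deriv γ s) (deriv γ s)) =
      f (γ s) ^ 2 * -(B (deriv γ s) (deriv γ s)) := by
    simp [conformalMetric]
  rw [this, Real.sqrt_mul (sq_nonneg _), Real.sqrt_sq (hf _).le, timeNorm]

theorem IsCausalOn.exists_partition (h : IsCausalOn B τ γ a b) :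
    ∃ (n : ℕ) (t : ℕ → ℝ), t 0 = a ∧ t n = b ∧
      ∀ i < n, IsSmoothCausalOn B τ γ (t i) (t (i + 1)) := by
  induction h with
  | @single b h => exact ⟨1, fun i => if i = 0 then a else b, by simp, by simp, by simpa using h⟩
  | @step b c _ h' ih =>
    obtain ⟨n, t, h0, hn, ht⟩ := ih
    refine ⟨n + 1, fun i => if i ≤ n then t i else c, by simpa using h0, by simp, fun i hi => ?_⟩
    rcases Nat.lt_succ_iff_lt_or_eq.1 hi with hi' | rfl
    · simpa [hi'.le, Nat.succ_le_of_lt hi'] using ht i hi'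
    · simpa [hn] using h'

theorem isCausalOn_of_partition {n : ℕ} {t : ℕ → ℝ}
    (ht : ∀ i < n + 1, IsSmoothCausalOn B τ γ (t i) (t (i + 1))) :
    IsCausalOn B τ γ (t 0) (t (n + 1)) := by
  induction n with
  | zero => exact .single (ht 0 (by simp))
  | succ n ih => exact (ih fun i hi => ht i (by omega)).step (ht (n + 1) (by omega))

theorem isFutureCausalCurve_conformalMetric (hf : ∀ x, 0 < f x) {x y : V} :
    IsFutureCausalCurve (conformalMetric f B) τ γ x y ↔
      γ 0 = x ∧ γ 1 = y ∧ IsCausalOn B τ γ 0 1 := by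
  unfold IsFutureCausalCurve
  simp only [futureCausal_conformalMetric hf]
  refine and_congr_right fun _ => and_congr_right fun _ => ⟨?_, fun h => h.exists_partition⟩
  rintro ⟨n, t, h0, hn, ht⟩
  cases n with
  | zero => exact absurd (h0.symm.trans hn) zero_ne_one
  | succ n => exact h0 ▸ hn ▸ isCausalOn_of_partition ht

theorem timeSeparation_eq (hf : ∀ x, 0 < f x) (x y : V) :
    timeSeparation (conformalMetric f B) τ x y =
      ⨆ (γ : ℝ → V) (_ : γ 0 = x ∧ γ 1 = y ∧ IsCausalOn B τ γ 0 1), curveLength B f γ 0 1 := by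
  simp only [timeSeparation, isFutureCausalCurve_conformalMetric hf,
    lorentzLength_conformalMetric hf]

theorem IsCausalOn.curveLength_le_timeSeparation (hf : ∀ x, 0 < f x) (h : IsCausalOn B τ γ a b) :
    curveLength B f γ a b ≤ timeSeparation (conformalMetric f B) τ (γ a) (γ b) := by
  have hab : 0 < b - a := sub_pos.2 h.lt
  have h1 := h.comp_affine hab a
  have h2 := curveLength_comp_affine (B := B) (f := f) (γ := γ) (a := a) (b := b) hab a
  rw [sub_self, zero_div, div_self hab.ne'] at h1 h2
  rw [timeSeparation_eq hf, ← h2]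
  exact le_iSup₂_of_le (fun s => γ ((b - a) * s + a)) ⟨by simp, by simp, h1⟩ le_rfl

theorem timeSeparation_add_le (hf : ∀ x, 0 < f x) {x y z : V} (hxy : y - x ∈ futureCausal B τ)
    (hyz : z - y ∈ futureCausal B τ) :
    timeSeparation (conformalMetric f B) τ x y + timeSeparation (conformalMetric f B) τ y z ≤
      timeSeparation (conformalMetric f B) τ x z := by
  rw [timeSeparation_eq hf x y, timeSeparation_eq hf y z]
  refine ENNReal.biSup_add_biSup_le' ⟨_, by simp, by simp, isCausalOn_line hxy x⟩
    ⟨_, by simp, by simp, isCausalOn_line hyz y⟩ ?_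
  rintro γ ⟨hγ0, hγ1, hγ⟩ δ ⟨hδ0, hδ1, hδ⟩
  let η : ℝ → V := fun s => if s ≤ 1 then γ s else δ (1 * s + -1)
  have e1 : EqOn η γ (Icc 0 1) := fun s hs => if_pos hs.2
  have e2 : EqOn η (fun s => δ (1 * s + -1)) (Icc 1 2) := fun s hs => by
    rcases hs.1.eq_or_lt with rfl | h
    · simp [η, hγ1, hδ0]
    · exact if_neg (not_le.2 h)
  have hδ' := hδ.comp_affine one_pos (-1)
  have hl := curveLength_comp_affine (B := B) (f := f) (γ := δ) (a := 0) (b := 1) one_pos (-1)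
  norm_num only at hδ' hl
  have hη := (hγ.congr e1).trans (hδ'.congr e2)
  have := hη.curveLength_le_timeSeparation hf
  rw [curveLength_add zero_le_one one_le_two, curveLength_congr e1, curveLength_congr e2, hl] at this
  have h0 : η 0 = x := by simp [η, hγ0]
  have h2 : η 2 = z := by
    have : ¬ (2 : ℝ) ≤ 1 := by norm_num
    simp only [η, this, if_false]
    norm_num [hδ1]
  rwa [h0, h2] at this

theorem exists_curve_of_lt_timeSeparation (hf : ∀ x, 0 < f x) {x y : V} {r : ENNReal}
    (h : r < timeSeparation (conformalMetric f B) τ x y) :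
    ∃ γ : ℝ → V, γ 0 = x ∧ γ 1 = y ∧ IsCausalOn B τ γ 0 1 ∧ r < curveLength B f γ 0 1 := by
  rw [timeSeparation_eq hf, lt_iSup_iff] at h
  obtain ⟨γ, h⟩ := h
  obtain ⟨⟨h0, h1, h2⟩, h3⟩ := lt_iSup_iff.1 h
  exact ⟨γ, h0, h1, h2, h3⟩

theorem timeSeparation_translate_le (hf : ∀ x, 0 < f x) {k : V} (hk : ∀ x, f (x + k) = f x)
    (x y : V) : timeSeparation (conformalMetric f B) τ x y ≤
      timeSeparation (conformalMetric f B) τ (x + k) (y + k) := by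
  rw [timeSeparation_eq hf x y]
  refine iSup₂_le ?_
  rintro γ ⟨rfl, rfl, hγ⟩
  have h := hγ.smul_add (μ := 1) (p := k) (q := 0) (by simp)
  have h' := h.curveLength_le_timeSeparation hf
  simpa [curveLength, hk] using h'

theorem le_timeSeparation (hf : ∀ x, 0 < f x) {m : ℝ} (hm : ∀ x, m ≤ f x) {x y : V}
    (hxy : y - x ∈ futureCausal B τ) :
    ENNReal.ofReal (m * timeNorm B (y - x)) ≤ timeSeparation (conformalMetric f B) τ x y := by
  have h := (isCausalOn_line hxy x).curveLength_le_timeSeparation hf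
  simp only [zero_smul, add_zero, one_smul, add_sub_cancel] at h
  refine le_trans ?_ h
  have hd : ∀ s : ℝ, deriv (fun s => x + s • (y - x)) s = y - x := fun s => by
    simpa using (((hasDerivAt_id s).smul_const (y - x)).const_add x).deriv
  calc ENNReal.ofReal (m * timeNorm B (y - x))
      = ∫⁻ _ in Icc (0 : ℝ) 1, ENNReal.ofReal (m * timeNorm B (y - x)) := by simp
    _ ≤ _ := lintegral_mono fun s => by
      rw [hd]
      exact ENNReal.ofReal_le_ofReal (mul_le_mul_of_nonneg_right (hm _) (timeNorm_nonneg _))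

end TimeSeparation

/-! ### Upper bounds by the flat Lorentzian norm. -/

section Bounds

variable {V : Type*} [NormedAddCommGroup V] [NormedSpace ℝ V] [FiniteDimensional ℝ V]
variable {B : LinearMap.BilinForm ℝ V} {τ : V} {γ δ : ℝ → V} {a b c : ℝ} {f : V → ℝ}

/-- Calibrate with `v ↦ -M * B v u / timeNorm B u`, using the reverse Cauchy-Schwarz inequality. -/
theorem timeSeparation_le_of_timelike (hB : IsLorentzian B) (hτ : B τ τ < 0) (hf : ∀ x, 0 < f x)
    {M : ℝ} (hM : ∀ x, f x ≤ M) {u : V} (hu : u ∈ futureCausal B τ) (huu : B u u < 0) (x y : V) :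
    timeSeparation (conformalMetric f B) τ x y ≤
      ENNReal.ofReal (M * (-(B (y - x) u) / timeNorm B u)) := by
  have hN := timeNorm_pos huu
  rw [timeSeparation_eq hf]
  refine iSup₂_le ?_
  rintro γ ⟨rfl, rfl, hγ⟩
  let ψ : V →L[ℝ] ℝ := LinearMap.toContinuousLinearMap ((-(M / timeNorm B u)) • B.flip u)
  have hψ : ∀ v, ψ v = M * (-(B v u) / timeNorm B u) := fun v => by
    have : ψ v = -(M / timeNorm B u) * B v u := rfl
    rw [this]
    ring
  rw [← hψ]
  refine hγ.curveLength_le hB hτ hf ψ fun x v hv => ?_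
  rw [hψ]
  have h1 := hB.timeNorm_mul_le hτ hv hu
  exact mul_le_mul (hM x) ((le_div_iff₀ hN).2 h1) (timeNorm_nonneg v) ((hf x).le.trans (hM x))

theorem timeSeparation_le (hB : IsLorentzian B) (hτ : B τ τ < 0) (hf : ∀ x, 0 < f x)
    {M : ℝ} (hM : ∀ x, f x ≤ M) {x y : V} (hxy : y - x ∈ futureCausal B τ) :
    timeSeparation (conformalMetric f B) τ x y ≤ ENNReal.ofReal (M * timeNorm B (y - x)) := by
  have hM0 : 0 < M := (hf 0).trans_le (hM 0)
  set v := y - x with hv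
  rcases hxy.2.1.lt_or_eq with h | h
  · refine (timeSeparation_le_of_timelike hB hτ hf hM hxy h x y).trans_eq ?_
    rw [← hv, ← sq_timeNorm hxy, sq, mul_div_cancel_right₀ _ (timeNorm_pos h).ne']
  -- a null vector is approximated by timelike ones
  · refine ENNReal.le_of_forall_pos_le_add fun η hη _ => le_add_left ?_
    have hl := height_pos hxy
    have hη' : (0 : ℝ) < η := hη
    -- Chosen so that `-B v (v + s • τ) = (η / M) ^ 2`; the calibrated bound is then at most `η`.
    set s : ℝ := (η / M) ^ 2 / height B τ v with hs
    have hs0 : 0 < s := by positivity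
    have hsl : s * height B τ v = (η / M) ^ 2 := by rw [hs]; field_simp
    have hsτ := smul_mem_futureCausal hs0 (self_mem_futureCausal hτ)
    have hu := hB.add_mem hτ hxy hsτ
    have hvu : -(B v (v + s • τ)) = (η / M) ^ 2 := by
      rw [← hsl, map_add, h, map_smul, height, smul_eq_mul]
      ring
    have huu : (η / M) ^ 2 ≤ timeNorm B (v + s • τ) ^ 2 := by
      rw [hB.sq_timeNorm_add hτ hxy hsτ, ← hsl]
      have : B v (s • τ) = -(s * height B τ v) := by simp [height]
      rw [this, neg_neg]
      have := mul_pos hs0 hl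
      linarith [sq_nonneg (timeNorm B v), sq_nonneg (timeNorm B (s • τ))]
    have hN : η / M ≤ timeNorm B (v + s • τ) := abs_le_of_sq_le_sq' huu (timeNorm_nonneg _) |>.2
    have hN0 : 0 < η / M := by positivity
    refine (timeSeparation_le_of_timelike hB hτ hf hM hu ?_ x y).trans ?_
    · have := sq_timeNorm hu
      have := pow_pos (hN0.trans_le hN) 2
      linarith
    · rw [← hv, hvu, ← ENNReal.ofReal_coe_nnreal]
      refine ENNReal.ofReal_le_ofReal ?_
      calc M * ((η / M) ^ 2 / timeNorm B (v + s • τ)) ≤ M * ((η / M) ^ 2 / (η / M)) := by gcongr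
        _ = (η : ℝ) := by field_simp

end Bounds

/-! ### The properties of the time separation used below, and time reversal. -/

section Abstract

variable {V : Type*} [NormedAddCommGroup V] [NormedSpace ℝ V]

/-- The properties of the time separation of a metric `f ^ 2 * B` with `m ≤ f ≤ M` and `f`
invariant under `Γ` from which its Lipschitz continuity follows. The number `κ` bounds the
logarithmic variation of `f`. -/
structure IsTimeSep (B : LinearMap.BilinForm ℝ V) (τ : V) (Γ : Submodule ℤ V) (m M κ : ℝ)
    (d : V → V → ℝ) : Prop where
  add_le : ∀ x y z, y - x ∈ futureCausal B τ → z - y ∈ futureCausal B τ → d x y + d y z ≤ d x z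
  translate_le : ∀ k ∈ Γ, ∀ x y, d x y ≤ d (x + k) (y + k)
  lower : ∀ x y, y - x ∈ futureCausal B τ → m * timeNorm B (y - x) ≤ d x y
  upper : ∀ x y, y - x ∈ futureCausal B τ → d x y ≤ M * timeNorm B (y - x)
  split : ∀ x y t δ, y - x ∈ futureCausal B τ → 0 < t → t < height B τ (y - x) → 0 < δ →
    ∃ z, z - x ∈ futureCausal B τ ∧ y - z ∈ futureCausal B τ ∧ height B τ (z - x) = t ∧
      d x y - δ ≤ d x z + d z y
  deform : ∀ x y a b l, y - x ∈ futureCausal B τ → b - a ∈ futureCausal B τ → 0 ≤ l → l ≤ 1 →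
    (1 - l * (1 + κ * (height B τ (y - x) + height B τ (b - a) + ‖a - x‖ + ‖b - y‖))) * d x y ≤
      d ((1 - l) • x + l • a) ((1 - l) • y + l • b)

variable {B : LinearMap.BilinForm ℝ V} {τ : V} {Γ : Submodule ℤ V} {m M κ : ℝ} {d : V → V → ℝ}

/-- Time reversal. -/
theorem IsTimeSep.reverse (hd : IsTimeSep B τ Γ m M κ d) :
    IsTimeSep B τ Γ m M κ (fun x y => d (-y) (-x)) where
  add_le x y z hxy hyz := by
    rw [add_comm]
    exact hd.add_le _ _ _ (by rwa [neg_sub_neg]) (by rwa [neg_sub_neg])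
  translate_le k hk x y := by
    rw [neg_add, neg_add]
    exact hd.translate_le (-k) (neg_mem hk) (-y) (-x)
  lower x y hxy := by
    have h := hd.lower (-y) (-x)
    rw [neg_sub_neg] at h
    exact h hxy
  upper x y hxy := by
    have h := hd.upper (-y) (-x)
    rw [neg_sub_neg] at h
    exact h hxy
  split x y t δ hxy ht hty hδ := by
    have e : -x - -y = y - x := by abel
    obtain ⟨z, h1, h2, h3, h4⟩ := hd.split (-y) (-x) (height B τ (y - x) - t) δ (by rwa [e])
      (by linarith) (by rw [e]; linarith) hδ
    have e1 : z - -y = y - -z := by abel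
    have e2 : -x - z = -z - x := by abel
    rw [e1] at h1 h3
    rw [e2] at h2
    refine ⟨-z, h2, h1, ?_, ?_⟩
    · have : -z - x = (y - x) - (y - -z) := by abel
      rw [this, height_sub, h3]
      ring
    · rw [neg_neg]
      linarith
  deform x y a b l hxy hab h0 h1 := by
    have e : -x - -y = y - x := by abel
    have e' : -a - -b = b - a := by abel
    have e1 : -a - -x = -(a - x) := by abel
    have e2 : -b - -y = -(b - y) := by abel
    have h := hd.deform (-y) (-x) (-b) (-a) l (by rwa [e]) (by rwa [e']) h0 h1
    rw [e, e', e1, e2, norm_neg, norm_neg] at h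
    have e3 : ∀ p q : V, (1 - l) • -p + l • -q = -((1 - l) • p + l • q) := fun p q => by module
    rw [e3, e3] at h
    convert h using 4
    ring

end Abstract

/-! ### Deformation of causal curves. -/

section Deform

variable {V : Type*} [NormedAddCommGroup V] [NormedSpace ℝ V]
variable {B : LinearMap.BilinForm ℝ V} {τ : V}

theorem IsLorentzian.le_timeNorm_combination (hB : IsLorentzian B) (hτ : B τ τ < 0) {v w : V}
    (hv : v ∈ futureCausal B τ) (hw : w ∈ futureCausal B τ) {l : ℝ} (h0 : 0 ≤ l) (h1 : l < 1) :
    (1 - l) • v + l • w ∈ futureCausal B τ ∧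
      (1 - l) * timeNorm B v ≤ timeNorm B ((1 - l) • v + l • w) := by
  rcases h0.eq_or_lt with rfl | h0
  · simpa using hv
  have h1' : 0 < 1 - l := sub_pos.2 h1
  have hv' := smul_mem_futureCausal h1' hv
  have hw' := smul_mem_futureCausal h0 hw
  refine ⟨hB.add_mem hτ hv' hw', ?_⟩
  rw [← timeNorm_smul h1'.le]
  linarith [hB.add_timeNorm_le hτ hv' hw', timeNorm_nonneg (B := B) (l • w)]

variable [FiniteDimensional ℝ V] {f : V → ℝ}

/-- The velocity keeps a fraction `1 - l` of its Lorentzian norm by the reverse triangle inequality.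
The curve moves by at most `l * (C + 1) * D`, so `f` keeps a fraction `1 - κ * l * D`. The product
of the two fractions is at least `1 - l * (1 + κ * D)`. -/
theorem IsCausalOn.curveLength_combination_ge (hB : IsLorentzian B) (hτ : B τ τ < 0)
    {m K C : ℝ} (hm : 0 < m) (hfm : ∀ x, m ≤ f x) (hK : 0 < K)
    (hfK : ∀ x y, |f x - f y| ≤ K * ‖x - y‖) (hC : 0 < C)
    (hnorm : ∀ v ∈ futureCausal B τ, ‖v‖ ≤ C * height B τ v) {γ : ℝ → V} (hγ : IsCausalOn B τ γ 0 1)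
    {a b : V} (hab : b - a ∈ futureCausal B τ) {l : ℝ} (h0 : 0 ≤ l) (h1 : l < 1) {D : ℝ}
    (hD : height B τ (γ 1 - γ 0) + height B τ (b - a) + ‖a - γ 0‖ ≤ D)
    (hθ : 0 < 1 - l * (1 + K * (C + 1) / m * D)) :
    ENNReal.ofReal (1 - l * (1 + K * (C + 1) / m * D)) * curveLength B f γ 0 1 ≤
      curveLength B f (fun s => (1 - l) • γ s + (l • a + s • (l • (b - a)))) 0 1 := by
  have hf : ∀ x, 0 < f x := fun x => hm.trans_le (hfm x)
  set δ : ℝ → V := fun s => (1 - l) • γ s + (l • a + s • (l • (b - a))) with hδ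
  set κ := K * (C + 1) / m with hκ
  have hκ0 : 0 < κ := by positivity
  have hhab := height_pos hab
  have hD0 : 0 < D := by
    have := height_pos (hγ.sub_mem hB hτ)
    have := norm_nonneg (a - γ 0)
    linarith
  unfold curveLength
  rw [← lintegral_const_mul' _ _ ENNReal.ofReal_ne_top]
  have hIoo := ae_restrict_Icc_of_forall_Ioo (a := 0) (b := 1) (p := fun s => s ∈ Ioo (0 : ℝ) 1)
    fun s hs => hs
  refine lintegral_mono_ae ?_
  filter_upwards [hγ.ae_deriv, hIoo] with s ⟨hs1, hs2⟩ hs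
  have hdist : ‖γ s - δ s‖ ≤ l * ((C + 1) * D) := by
    have e : γ s - δ s = l • ((γ s - γ 0) - (a - γ 0) - s • (b - a)) := by
      simp only [hδ]
      module
    have c1 := (hγ.mono le_rfl hs.1 hs.2.le).sub_mem hB hτ
    have c2 := height_pos ((hγ.mono hs.1.le hs.2 le_rfl).sub_mem hB hτ)
    have c3 : height B τ (γ 1 - γ 0) = height B τ (γ s - γ 0) + height B τ (γ 1 - γ s) := by
      rw [← height_add]
      congr 1
      abel
    rw [e, norm_smul, Real.norm_of_nonneg h0]
    refine mul_le_mul_of_nonneg_left ?_ h0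
    have n1 := hnorm _ c1
    have n2 := hnorm _ hab
    have n3 : ‖s • (b - a)‖ ≤ ‖b - a‖ := by
      rw [norm_smul, Real.norm_of_nonneg hs.1.le]
      exact mul_le_of_le_one_left (norm_nonneg _) hs.2.le
    have n4 := norm_sub_le (γ s - γ 0 - (a - γ 0)) (s • (b - a))
    have n5 := norm_sub_le (γ s - γ 0) (a - γ 0)
    have n6 := norm_nonneg (a - γ 0)
    have n7 := mul_le_mul_of_nonneg_left hD hC.le
    have n8 := mul_pos hC c2
    have n9 := mul_nonneg hC.le n6
    have n10 := height_pos c1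
    nlinarith
  have hfδ : (1 - κ * l * D) * f (γ s) ≤ f (δ s) := by
    have k1 := (le_abs_self _).trans (hfK (γ s) (δ s))
    have k2 : K * ‖γ s - δ s‖ ≤ K * (l * ((C + 1) * D)) := by gcongr
    have k3 : K * (l * ((C + 1) * D)) = κ * l * D * m := by rw [hκ]; field_simp
    have k4 : κ * l * D * m ≤ κ * l * D * f (γ s) := by
      gcongr
      exact hfm _
    linarith
  have hder : deriv δ s = (1 - l) • deriv γ s + l • (b - a) := by
    have h1 : HasDerivAt (fun s : ℝ => l • a + s • (l • (b - a))) (l • (b - a)) s := by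
      simpa using ((hasDerivAt_id s).smul_const (l • (b - a))).const_add (l • a)
    exact ((hs1.hasDerivAt.const_smul (1 - l)).add h1).deriv
  have hN := (hB.le_timeNorm_combination hτ hs2 hab h0 h1).2
  rw [← hder] at hN
  rw [← ENNReal.ofReal_mul hθ.le]
  refine ENNReal.ofReal_le_ofReal ?_
  have hN0 := timeNorm_nonneg (B := B) (deriv γ s)
  have hX : 0 ≤ κ * l * D := by positivity
  have hX1 : 0 ≤ 1 - κ * l * D := by nlinarith
  calc (1 - l * (1 + κ * D)) * (f (γ s) * timeNorm B (deriv γ s))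
      ≤ ((1 - κ * l * D) * (1 - l)) * (f (γ s) * timeNorm B (deriv γ s)) := by
        refine mul_le_mul_of_nonneg_right ?_ (mul_nonneg (hf _).le hN0)
        nlinarith [mul_nonneg h0 hX]
    _ = ((1 - κ * l * D) * f (γ s)) * ((1 - l) * timeNorm B (deriv γ s)) := by ring
    _ ≤ f (δ s) * timeNorm B (deriv δ s) :=
        mul_le_mul hfδ hN (mul_nonneg (by linarith) hN0) (hf _).le

theorem isTimeSep_timeSeparation (hB : IsLorentzian B) (hτ : B τ τ < 0) {Γ : Submodule ℤ V}
    (hfΓ : ∀ k ∈ Γ, ∀ x, f (x + k) = f x)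
    {m M K C : ℝ} (hm : 0 < m) (hfm : ∀ x, m ≤ f x) (hfM : ∀ x, f x ≤ M) (hK : 0 < K)
    (hfK : ∀ x y, |f x - f y| ≤ K * ‖x - y‖) (hC : 0 < C)
    (hnorm : ∀ v ∈ futureCausal B τ, ‖v‖ ≤ C * height B τ v)
    (hfin : ∀ x y, timeSeparation (conformalMetric f B) τ x y ≠ ⊤) :
    IsTimeSep B τ Γ m M (K * (C + 1) / m)
      (fun x y => (timeSeparation (conformalMetric f B) τ x y).toReal) := by
  have hf : ∀ x, 0 < f x := fun x => hm.trans_le (hfm x)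
  have hM : 0 < M := (hf 0).trans_le (hfM 0)
  constructor
  · intro x y z hxy hyz
    rw [← ENNReal.toReal_add (hfin _ _) (hfin _ _)]
    exact ENNReal.toReal_mono (hfin _ _) (timeSeparation_add_le hf hxy hyz)
  · intro k hk x y
    exact ENNReal.toReal_mono (hfin _ _) (timeSeparation_translate_le hf (hfΓ k hk) x y)
  · intro x y hxy
    exact (ENNReal.ofReal_le_iff_le_toReal (hfin _ _)).1 (le_timeSeparation hf hfm hxy)
  · intro x y hxy
    exact ENNReal.toReal_le_of_le_ofReal (mul_nonneg hM.le (timeNorm_nonneg _))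
      (timeSeparation_le hB hτ hf hfM hxy)
  · intro x y t δ hxy ht hty hδ
    obtain ⟨γ, h0, h1, hγ, hl⟩ : ∃ γ : ℝ → V, γ 0 = x ∧ γ 1 = y ∧ IsCausalOn B τ γ 0 1 ∧
        timeSeparation (conformalMetric f B) τ x y ≤
          curveLength B f γ 0 1 + ENNReal.ofReal δ := by
      rcases eq_or_ne (timeSeparation (conformalMetric f B) τ x y) 0 with hz | hz
      · exact ⟨_, by simp, by simp, isCausalOn_line hxy x, by simp [hz]⟩
      · obtain ⟨γ, h0, h1, hγ, hl⟩ := exists_curve_of_lt_timeSeparation hf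
          (ENNReal.sub_lt_self (hfin x y) hz (ENNReal.ofReal_pos.2 hδ).ne')
        exact ⟨γ, h0, h1, hγ, tsub_le_iff_right.1 hl.le⟩
    have hcont : ContinuousOn (fun s => height B τ (γ s - x)) (Icc 0 1) :=
      (continuous_height (B := B) (τ := τ)).comp_continuousOn
        (hγ.continuousOn.sub continuousOn_const)
    -- Cut an almost maximal curve where its height over `x` equals `t`.
    obtain ⟨s, hs, hst⟩ := intermediate_value_Ioo zero_le_one hcont (show t ∈ Ioo _ _ by
      simp only [h0, h1, sub_self]
      exact ⟨by simpa [height] using ht, hty⟩)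
    have c1 := hγ.mono le_rfl hs.1 hs.2.le
    have c2 := hγ.mono hs.1.le hs.2 le_rfl
    refine ⟨γ s, h0 ▸ c1.sub_mem hB hτ, h1 ▸ c2.sub_mem hB hτ, hst, ?_⟩
    rw [curveLength_add hs.1.le hs.2.le] at hl
    have l1 := c1.curveLength_le_timeSeparation hf
    have l2 := c2.curveLength_le_timeSeparation hf
    rw [h0] at l1
    rw [h1] at l2
    have := ENNReal.toReal_mono (by finiteness [hfin x (γ s), hfin (γ s) y])
      (hl.trans (add_le_add (add_le_add l1 l2) le_rfl))
    rw [ENNReal.toReal_add (by finiteness [hfin x (γ s), hfin (γ s) y]) (by finiteness),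
      ENNReal.toReal_add (hfin _ _) (hfin _ _), ENNReal.toReal_ofReal hδ.le] at this
    linarith
  · intro x y a b l hxy hab h0 h1
    -- Displacements at both endpoints are counted, which keeps `deform` invariant under time
    -- reversal.
    set D := height B τ (y - x) + height B τ (b - a) + ‖a - x‖ + ‖b - y‖ with hD
    rcases le_or_gt (1 - l * (1 + K * (C + 1) / m * D)) 0 with hθ | hθ
    · exact (mul_nonpos_of_nonpos_of_nonneg hθ ENNReal.toReal_nonneg).trans ENNReal.toReal_nonneg
    have hD0 : 0 ≤ D := by
      have := height_pos hxy
      have := height_pos hab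
      positivity
    have hl1 : l < 1 := by
      rcases h1.lt_or_eq with h | rfl
      · exact h
      · have : 0 ≤ K * (C + 1) / m * D := by positivity
        linarith
    have key : ENNReal.ofReal (1 - l * (1 + K * (C + 1) / m * D)) *
        timeSeparation (conformalMetric f B) τ x y ≤
        timeSeparation (conformalMetric f B) τ ((1 - l) • x + l • a) ((1 - l) • y + l • b) := by
      rw [timeSeparation_eq hf x y]
      simp only [ENNReal.mul_iSup]
      refine iSup₂_le ?_
      rintro γ ⟨rfl, rfl, hγ⟩
      have hδ := hγ.smul_add (μ := 1 - l) (p := l • a) (q := l • (b - a)) fun v hv =>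
        (hB.le_timeNorm_combination hτ hv hab h0 hl1).1
      have h2 := hγ.curveLength_combination_ge hB hτ hm hfm hK hfK hC hnorm hab h0 hl1 (D := D)
        (by linarith [norm_nonneg (b - γ 1)]) hθ
      have h3 := hδ.curveLength_le_timeSeparation hf
      have e0 : (1 - l) • γ 0 + (l • a + (0 : ℝ) • (l • (b - a))) = (1 - l) • γ 0 + l • a := by
        simp
      have e1 : (1 - l) • γ 1 + (l • a + (1 : ℝ) • (l • (b - a))) = (1 - l) • γ 1 + l • b := by
        module
      simp only [e0, e1] at h3
      exact h2.trans h3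
    have := ENNReal.toReal_mono (hfin _ _) key
    rwa [ENNReal.toReal_mul, ENNReal.toReal_ofReal hθ.le] at this

theorem timeSeparation_ne_top (hB : IsLorentzian B) (hτ : B τ τ < 0) (hf : ∀ x, 0 < f x)
    {M : ℝ} (hM : ∀ x, f x ≤ M) (x y : V) :
    timeSeparation (conformalMetric f B) τ x y ≠ ⊤ :=
  ne_top_of_le_ne_top ENNReal.ofReal_ne_top
    (timeSeparation_le_of_timelike hB hτ hf hM (self_mem_futureCausal hτ) hτ x y)

end Deform

/-! ### Cutting out lattice vectors, and shortening at bounded height. -/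

section Abstract

variable {V : Type*} [NormedAddCommGroup V] [NormedSpace ℝ V]
variable {B : LinearMap.BilinForm ℝ V} {τ : V} {Γ : Submodule ℤ V} {m M κ : ℝ} {d : V → V → ℝ}

theorem IsTimeSep.nonneg (hd : IsTimeSep B τ Γ m M κ d) (hm : 0 < m) {x y : V}
    (hxy : y - x ∈ futureCausal B τ) : 0 ≤ d x y :=
  (mul_nonneg hm.le (timeNorm_nonneg _)).trans (hd.lower x y hxy)

/-- If the time separation of `x` and `z` is large in proportion to their distance, then the
lattice vector `k` can be cut out between `x` and `z` at a bounded cost. -/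
theorem IsTimeSep.sub_lattice_le (hd : IsTimeSep B τ Γ m M κ d) (hm : 0 < m)
    (hB : IsLorentzian B) (hτ : B τ τ < 0) {T a A δ : ℝ} (hT : 0 < T) (hδ : 0 < δ) {k : V}
    (hk : k ∈ Γ)
    (hcut : ∀ p q, q - p ∈ futureCausal B τ → height B τ (q - p) = T → a ≤ d p q →
      q - p - k ∈ futureCausal B τ)
    (hA : ∀ p q, q - p ∈ futureCausal B τ → height B τ (q - p) = T → d p q ≤ A)
    (n : ℕ) {x z : V} (hxz : z - x ∈ futureCausal B τ) (hn : height B τ (z - x) = (n + 1) * T)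
    (hd_ge : (n + 1) * (a + δ) ≤ d x z) :
    z - k - x ∈ futureCausal B τ ∧ d x z - A - n * δ ≤ d x (z - k) := by
  induction n generalizing x with
  | zero =>
    simp only [Nat.cast_zero, zero_add, one_mul, zero_mul, sub_zero] at hn hd_ge ⊢
    have h := hcut x z hxz hn (by linarith)
    rw [sub_right_comm] at h
    exact ⟨h, by linarith [hd.nonneg hm h, hA x z hxz hn]⟩
  | succ n ih =>
    push_cast at hn hd_ge ⊢
    have hnT : 0 ≤ n * T := by positivity
    obtain ⟨w, h1, h2, h3, h4⟩ := hd.split x z T δ hxz hT (by rw [hn]; linarith) hδ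
    -- Either the first block of height `T` is long and `k` is cut out of it, losing at most `A`, or
    -- the remainder inherits the average lower bound.
    rcases le_or_gt a (d x w) with ha | ha
    · have h5 := hcut x w h1 h3 ha
      rw [sub_right_comm] at h5
      have h6 : z - k - (w - k) ∈ futureCausal B τ := by rwa [sub_sub_sub_cancel_right]
      have h7 := hd.add_le x (w - k) (z - k) h5 h6
      have h8 := hd.translate_le (-k) (neg_mem hk) w z
      rw [← sub_eq_add_neg, ← sub_eq_add_neg] at h8
      refine ⟨?_, ?_⟩
      · have := hB.add_mem hτ h5 h6
        rwa [sub_add_sub_cancel'] at this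
      · have := hA x w h1 h3
        have := hd.nonneg hm h5
        have : 0 ≤ n * δ := by positivity
        linarith
    · have h5 : height B τ (z - w) = (n + 1) * T := by
        have : z - w = (z - x) - (w - x) := by abel
        rw [this, height_sub, hn, h3]
        ring
      obtain ⟨h6, h7⟩ := ih h2 h5 (by linarith)
      refine ⟨?_, ?_⟩
      · have := hB.add_mem hτ h1 h6
        rwa [sub_add_sub_cancel'] at this
      · have := hd.add_le x w (z - k) h1 h6
        linarith

/-- Deform towards the segment from `x` to `y - (e * h) • τ`. The loss is `l = s / (e * h)` times a
bounded factor times `d x y`, which is of order `h`; the height cancels, so `K` does not blow up as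
`h → 0`. -/
theorem IsTimeSep.exists_sub_smul_le_of_height_le (hd : IsTimeSep B τ Γ m M κ d) (hM : 0 < M)
    (hκ : 0 ≤ κ) (hB : IsLorentzian B) (hτ : B τ τ < 0) {c : ℝ} (hc : 0 < c) (R : ℝ) :
    ∃ K : ℝ, 0 ≤ K ∧ ∀ x y s, y - x ∈ steep B τ c → height B τ (y - x) ≤ R → 0 < s →
      2 * s ≤ c ^ 2 * height B τ (y - x) → d x y - K * s ≤ d x (y - s • τ) := by
  have hN := timeNorm_pos hτ
  set e := c ^ 2 / 2 with he
  have he0 : 0 < e := by positivity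
  refine ⟨(1 + κ * ((2 + e * ‖τ‖) * |R|)) / e * (M / timeNorm B τ), by positivity,
    fun x y s hxy hR hs hsc => ?_⟩
  have hh := height_pos hxy.1
  set h := height B τ (y - x) with hhd
  set l := s / (e * h) with hl
  have hl0 : 0 < l := by positivity
  have hl1 : l ≤ 1 := by
    rw [hl, div_le_one (by positivity), he]
    linarith
  have hmem : y - (e * h) • τ - x ∈ futureCausal B τ := by
    have := hB.sub_smul_mem hτ (s := e * h) hc hxy (by rw [← hhd, he]; linarith)
    rwa [sub_right_comm] at this
  have hdef := hd.deform x y x (y - (e * h) • τ) l hxy.1 hmem hl0.le hl1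
  have e1 : (1 - l) • x + l • x = x := by module
  have e2 : (1 - l) • y + l • (y - (e * h) • τ) = y - s • τ := by
    have : s = l * (e * h) := by rw [hl]; field_simp
    rw [this]
    module
  have e3 : height B τ (y - (e * h) • τ - x) ≤ h := by
    rw [sub_right_comm, height_sub, height_smul]
    have : 0 ≤ e * h * height B τ τ :=
      mul_nonneg (by positivity) (height_pos (self_mem_futureCausal hτ)).le
    linarith
  have e4 : ‖y - (e * h) • τ - y‖ = e * h * ‖τ‖ := by
    rw [sub_sub_cancel_left, norm_neg, norm_smul, Real.norm_of_nonneg (by positivity)]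
  rw [e1, e2, sub_self, norm_zero, e4, ← hhd] at hdef
  set D := h + height B τ (y - (e * h) • τ - x) + 0 + e * h * ‖τ‖ with hD
  have hD0 : D ≤ (2 + e * ‖τ‖) * |R| := by
    have h1 : D ≤ (2 + e * ‖τ‖) * h := by rw [hD]; linarith
    refine h1.trans ?_
    gcongr
    exact hR.trans (le_abs_self R)
  have hdM : d x y ≤ M / timeNorm B τ * h := by
    refine (hd.upper x y hxy.1).trans ?_
    rw [div_mul_eq_mul_div, le_div_iff₀ hN, mul_assoc]
    exact mul_le_mul_of_nonneg_left (hB.timeNorm_le_height hτ hxy.1) hM.le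
  have hloss : l * (1 + κ * D) * d x y ≤
      (1 + κ * ((2 + e * ‖τ‖) * |R|)) / e * (M / timeNorm B τ) * s := by
    have hD1 : 0 ≤ D := by
      have := height_pos hmem
      positivity
    calc l * (1 + κ * D) * d x y
        ≤ l * (1 + κ * D) * (M / timeNorm B τ * h) :=
          mul_le_mul_of_nonneg_left hdM (by positivity)
      _ ≤ l * (1 + κ * ((2 + e * ‖τ‖) * |R|)) * (M / timeNorm B τ * h) := by gcongr
      _ = _ := by rw [hl]; field_simp
  linarith

theorem IsLorentzian.convex_steep (hB : IsLorentzian B) (hτ : B τ τ < 0) (c : ℝ) :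
    Convex ℝ (steep B τ c) :=
  convex_iff_forall_pos.2 fun _ hu _ hv _ _ ha hb _ =>
    hB.steep_add hτ (steep_smul ha hu) (steep_smul hb hv)

end Abstract

/-! ### Uniform shortening, and the Lipschitz estimate. -/

section FiniteDimensional

variable {V : Type*} [NormedAddCommGroup V] [NormedSpace ℝ V] [FiniteDimensional ℝ V]
variable {B : LinearMap.BilinForm ℝ V} {τ : V} {Γ : Submodule ℤ V} {m M κ : ℝ} {d : V → V → ℝ}

/-- Makes the previous estimate independent of the height by applying it only to a terminal piece,
shown to be steep by a lattice exchange. -/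
theorem IsTimeSep.exists_sub_smul_le (hd : IsTimeSep B τ Γ m M κ d) (hm : 0 < m) (hM : 0 < M)
    (hκ : 0 ≤ κ) (hB : IsLorentzian B) (hτ : B τ τ < 0) [DiscreteTopology Γ] [IsZLattice ℝ Γ]
    {c : ℝ} (hc : 0 < c) :
    ∃ K s₀ : ℝ, 0 ≤ K ∧ 0 < s₀ ∧ ∀ x y s, y - x ∈ steep B τ c → 0 < s → s ≤ s₀ →
      s ≤ s₀ * height B τ (y - x) → d x y - K * s ≤ d x (y - s • τ) := by
  have hN := timeNorm_pos hτ
  obtain ⟨k, hk, hkτ⟩ := exists_lattice_sub_mem hτ Γ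
  have hkT : k ∈ futureCausal B τ := by
    simpa using hB.add_mem hτ hkτ (self_mem_futureCausal hτ)
  obtain ⟨sk, hsk, hskT⟩ : ∃ sk : ℝ, 0 < sk ∧ -k + sk • τ ∈ futureCausal B τ := by
    obtain ⟨A, hA, hAw⟩ := exists_add_smul_mem (V := V) hτ
    exact ⟨A * ‖k‖ + 1, by positivity, hAw _ _ (by positivity) (by rw [norm_neg]; linarith)⟩
  -- With this slope, blocks shorter than `a = c₁ * M * T` account for at most a quarter of the
  -- lower bound `m * c * h`; `T` is the height at which a block of slope `c₁` leaves room for `sk •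
  -- τ`, hence for `k`.
  set c₁ := m * c / (4 * M) with hc₁
  have hc₁0 : 0 < c₁ := by positivity
  set T := 2 * sk / c₁ ^ 2 with hT
  have hT0 : 0 < T := by positivity
  set a := c₁ * M * T with ha
  have ha0 : 0 < a := by positivity
  have hcut : ∀ p q, q - p ∈ futureCausal B τ → height B τ (q - p) = T → a ≤ d p q →
      q - p - k ∈ futureCausal B τ := by
    intro p q hpq hh had
    have hst : q - p ∈ steep B τ c₁ := by
      refine ⟨hpq, ?_⟩
      rw [hh]
      have : M * (c₁ * T) ≤ M * timeNorm B (q - p) := by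
        linarith [hd.upper p q hpq]
      exact le_of_mul_le_mul_left this hM
    have h1 := hB.sub_smul_mem hτ (s := sk) hc₁0 hst (by
      rw [hh, hT]
      apply le_of_eq
      field_simp)
    have h2 := hB.add_mem hτ h1 hskT
    convert h2 using 1
    abel
  set A := M * (T / timeNorm B τ) with hA
  have hA0 : 0 < A := by positivity
  have hAle : ∀ p q, q - p ∈ futureCausal B τ → height B τ (q - p) = T → d p q ≤ A := by
    intro p q hpq hh
    refine (hd.upper p q hpq).trans (mul_le_mul_of_nonneg_left ?_ hM.le)
    rw [le_div_iff₀ hN, ← hh]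
    exact hB.timeNorm_le_height hτ hpq
  -- Large enough that `m * √(2 * R)`, the gain from adding `k` to the last piece, exceeds the total
  -- cost `A + 2 + M`.
  set R := (A + 2 + M) ^ 2 / m ^ 2 with hR
  have hR0 : 0 < R := by positivity
  -- Above this height at least one block of height `T` fits, and discarding a last piece of
  -- separation at most `M` keeps half of `m * c * h`.
  set R₀ := R + T + 2 * (1 + M) / (m * c) with hR₀
  set c₂ := 1 / (R + T) with hc₂
  have hc₂0 : 0 < c₂ := by positivity
  obtain ⟨K₁, hK₁, hnear⟩ := hd.exists_sub_smul_le_of_height_le hM hκ hB hτ hc R₀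
  obtain ⟨K₂, hK₂, hfar⟩ := hd.exists_sub_smul_le_of_height_le hM hκ hB hτ hc₂0 (R + T)
  refine ⟨K₁ + K₂, min (c ^ 2 / 2) (c₂ ^ 2 * R / 2), by positivity, by positivity,
    fun x y s hxy hs hs₀ hs₀h => ?_⟩
  have hh := height_pos hxy.1
  rcases le_or_gt (height B τ (y - x)) R₀ with hle | hgt
  · have h1 : s ≤ c ^ 2 / 2 * height B τ (y - x) :=
      hs₀h.trans (mul_le_mul_of_nonneg_right (min_le_left _ _) hh.le)
    have h2 := hnear x y s hxy hle hs (by linarith)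
    have := mul_nonneg hK₂ hs.le
    linarith
  set h := height B τ (y - x) with hhd
  have hextra : 0 < 2 * (1 + M) / (m * c) := by positivity
  have hfl1 : 1 ≤ (h - R) / T := by
    rw [le_div_iff₀ hT0]
    linarith
  -- The initial part consists of `n + 1` blocks, leaving a last piece of height between `R` and `R
  -- + T`.
  obtain ⟨n, hn⟩ : ∃ n : ℕ, ⌊(h - R) / T⌋₊ = n + 1 :=
    Nat.exists_eq_succ_of_ne_zero (Nat.floor_pos.2 hfl1).ne'
  have hn1 : ((n : ℝ) + 1) * T ≤ h - R := by
    have := Nat.floor_le (zero_le_one.trans hfl1)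
    rw [hn, le_div_iff₀ hT0] at this
    exact_mod_cast this
  have hn2 : h - R < ((n : ℝ) + 2) * T := by
    have := Nat.lt_floor_add_one ((h - R) / T)
    rw [hn, div_lt_iff₀ hT0] at this
    push_cast at this
    linarith
  have hnT : 0 < ((n : ℝ) + 1) * T := by positivity
  refine le_of_forall_pos_sub_le fun ε hε => ?_
  obtain ⟨z, hxz, hzy, hzt, hzd⟩ := hd.split x y ((n + 1) * T) (min ε 1) hxy.1 hnT
    (by linarith) (by positivity)
  have hε1 := min_le_left ε 1
  have hε2 := min_le_right ε 1
  have hhz : height B τ (y - z) = h - (n + 1) * T := by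
    have : y - z = (y - x) - (z - x) := by abel
    rw [this, height_sub, hzt]
  -- The lattice exchange: the last piece is not nearly null.
  have hclaim : 1 ≤ timeNorm B (y - z) := by
    by_contra! hlt
    have hzyM : d z y ≤ M :=
      (hd.upper z y hzy).trans (mul_le_of_le_one_right hM.le hlt.le)
    have hlow : m * (c * h) ≤ d x y :=
      (mul_le_mul_of_nonneg_left hxy.2 hm.le).trans (hd.lower x y hxy.1)
    have hbig : 2 * (1 + M) ≤ m * c * h := by
      have : 2 * (1 + M) / (m * c) ≤ h := by linarith
      rwa [div_le_iff₀' (by positivity)] at this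
    set δ := min a (1 / ((n : ℝ) + 1)) with hδ
    have hδ0 : 0 < δ := by positivity
    have hδa : δ ≤ a := min_le_left _ _
    have hδn : ((n : ℝ) + 1) * δ ≤ 1 := by
      have := min_le_right a (1 / ((n : ℝ) + 1))
      rwa [← hδ, le_div_iff₀' (by positivity)] at this
    have hge : ((n : ℝ) + 1) * (a + δ) ≤ d x z := by
      have h1 : ((n : ℝ) + 1) * (a + δ) ≤ ((n : ℝ) + 1) * (a + a) := by gcongr
      have h2 : ((n : ℝ) + 1) * (a + a) = 2 * (c₁ * M) * (((n : ℝ) + 1) * T) := by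
        rw [ha]; ring
      have h3 : 2 * (c₁ * M) * (((n : ℝ) + 1) * T) ≤ 2 * (c₁ * M) * h := by
        gcongr
        linarith
      have h4 : 2 * (c₁ * M) * h = m * c * h / 2 := by rw [hc₁]; field_simp; ring
      linarith
    obtain ⟨hm1, hm2⟩ := hd.sub_lattice_le hm hB hτ hT0 hδ0 hk hcut hAle n hxz hzt hge
    have e : y - (z - k) = (y - z) + k := by abel
    have hmem : y - (z - k) ∈ futureCausal B τ := e ▸ hB.add_mem hτ hzy hkT
    have h5 := hd.add_le x (z - k) y hm1 hmem
    have h6 := hd.lower (z - k) y hmem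
    -- As `k - τ` is causal, `-B (y - z) k` is at least the height of `y - z`, hence at least `R`.
    have h7 : 2 * R ≤ timeNorm B (y - (z - k)) ^ 2 := by
      rw [e, hB.sq_timeNorm_add hτ hzy hkT]
      have h8 := hB.apply_nonpos hτ hzy hkτ
      have h9 : B (y - z) (k - τ) = B (y - z) k + height B τ (y - z) := by
        rw [map_sub, height, sub_eq_add_neg]
      have := sq_nonneg (timeNorm B (y - z))
      have := sq_nonneg (timeNorm B k)
      linarith
    have h10 : m * timeNorm B (y - (z - k)) ≤ A + 2 + M := by
      linarith
    have h11 : m ^ 2 * (2 * R) ≤ (A + 2 + M) ^ 2 := by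
      calc m ^ 2 * (2 * R) ≤ m ^ 2 * timeNorm B (y - (z - k)) ^ 2 := by gcongr
        _ = (m * timeNorm B (y - (z - k))) ^ 2 := by ring
        _ ≤ (A + 2 + M) ^ 2 :=
          pow_le_pow_left₀ (mul_nonneg hm.le (timeNorm_nonneg _)) h10 2
    have h12 : m ^ 2 * R = (A + 2 + M) ^ 2 := by rw [hR]; field_simp
    have := mul_pos (pow_pos hm 2) hR0
    linarith
  have hzyR : height B τ (y - z) ≤ R + T := by rw [hhz]; linarith
  have hRz : R ≤ height B τ (y - z) := by rw [hhz]; linarith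
  have hst : y - z ∈ steep B τ c₂ := by
    refine ⟨hzy, le_trans ?_ hclaim⟩
    rw [hc₂, one_div, inv_mul_le_iff₀ (by positivity), mul_one]
    exact hzyR
  have hs2 : 2 * s ≤ c₂ ^ 2 * height B τ (y - z) := by
    have h1 : s ≤ c₂ ^ 2 * R / 2 := hs₀.trans (min_le_right _ _)
    have h2 : c₂ ^ 2 * R ≤ c₂ ^ 2 * height B τ (y - z) := by gcongr
    linarith
  have h1 := hfar z y s hst hzyR hs hs2
  have hmem : y - s • τ - z ∈ futureCausal B τ := by
    have := hB.sub_smul_mem hτ (s := s) hc₂0 hst hs2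
    rwa [sub_right_comm] at this
  have h2 := hd.add_le x z (y - s • τ) hxz hmem
  have := mul_nonneg hK₁ hs.le
  linarith

/-- Shrink the pair at both ends by `s • τ` and join through `x' ≤ x + s • τ ≤ y - s • τ ≤ y'`. Only
the permitted radius depends on the height, not `L`. -/
theorem IsTimeSep.exists_local_bound (hd : IsTimeSep B τ Γ m M κ d) (hm : 0 < m) (hM : 0 < M)
    (hκ : 0 ≤ κ) (hB : IsLorentzian B) (hτ : B τ τ < 0) [DiscreteTopology Γ] [IsZLattice ℝ Γ]
    {c : ℝ} (hc : 0 < c) :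
    ∃ L δ : ℝ, 0 ≤ L ∧ 0 < δ ∧ ∀ p q : V × V, p.2 - p.1 ∈ steep B τ c → ‖q - p‖ ≤ δ →
      ‖q - p‖ ≤ δ * height B τ (p.2 - p.1) → d p.1 p.2 - L * ‖q - p‖ ≤ d q.1 q.2 := by
  obtain ⟨K₁, s₁, hK₁, hs₁, hend⟩ := hd.exists_sub_smul_le hm hM hκ hB hτ hc
  obtain ⟨K₂, s₂, hK₂, hs₂, hstart⟩ :=
    hd.reverse.exists_sub_smul_le hm hM hκ hB hτ (half_pos hc)
  obtain ⟨A, hA, hAw⟩ := exists_add_smul_mem (V := V) hτ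
  have hσ := height_pos (self_mem_futureCausal hτ)
  set σ := height B τ τ
  -- The bound `c ^ 2 / 4` keeps the pair steep with slope `c / 2` after the first shift, `1 / (2 *
  -- σ)` keeps half of its height, and `s₂ / 2` compensates for that halving.
  set e := min s₁ (min (s₂ / 2) (min (c ^ 2 / 4) (1 / (2 * σ)))) with he
  have he0 : 0 < e := by positivity
  have e1 : e ≤ s₁ := min_le_left _ _
  have e2 : e ≤ s₂ / 2 := (min_le_right _ _).trans (min_le_left _ _)
  have e3 : e ≤ c ^ 2 / 4 :=
    (min_le_right _ _).trans ((min_le_right _ _).trans (min_le_left _ _))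
  have e4 : e ≤ 1 / (2 * σ) :=
    (min_le_right _ _).trans ((min_le_right _ _).trans (min_le_right _ _))
  refine ⟨(K₁ + K₂) * A, e / A, by positivity, by positivity, ?_⟩
  rintro ⟨x, y⟩ ⟨x', y'⟩ hxy hδ hδh
  simp only at hxy hδh ⊢
  set ρ := ‖(x', y') - (x, y)‖ with hρ
  have hh := height_pos hxy.1
  set h := height B τ (y - x) with hhd
  rcases (norm_nonneg _ : 0 ≤ ρ).eq_or_lt with h0 | hρ0
  · have h1 := norm_eq_zero.1 h0.symm
    rw [sub_eq_zero, Prod.mk.injEq] at h1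
    rw [hρ, ← h0, h1.1, h1.2, mul_zero, sub_zero]
  have hx : ‖x - x'‖ ≤ ρ := by
    rw [norm_sub_rev]
    exact norm_fst_le ((x', y') - (x, y))
  have hy : ‖y' - y‖ ≤ ρ := norm_snd_le ((x', y') - (x, y))
  set s := A * ρ with hs
  have hs0 : 0 < s := by positivity
  have hse : s ≤ e := by
    rw [le_div_iff₀ hA] at hδ
    linarith
  have hseh : s ≤ e * h := by
    rw [div_mul_eq_mul_div, le_div_iff₀ hA] at hδh
    linarith
  have h1 := hend x y s hxy hs0 (hse.trans e1) (hseh.trans (by gcongr))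
  have h4s : 4 * s ≤ c ^ 2 * h := by
    have : e * h ≤ c ^ 2 / 4 * h := by gcongr
    linarith
  have hmid := hB.sub_smul_mem_steep hτ hc hxy hs0.le h4s
  rw [sub_right_comm] at hmid
  have hhmid : h / 2 ≤ height B τ (y - s • τ - x) := by
    rw [sub_right_comm, height_sub, height_smul]
    have h5 : s * σ ≤ h / 2 := by
      calc s * σ ≤ 1 / (2 * σ) * h * σ := by
            gcongr
            exact hseh.trans (by gcongr)
        _ = h / 2 := by field_simp
    linarith
  have h2 := hstart (-(y - s • τ)) (-x) s (by rwa [neg_sub_neg]) hs0 (by linarith) (by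
    rw [neg_sub_neg]
    calc s ≤ e * h := hseh
      _ ≤ s₂ / 2 * h := by gcongr
      _ = s₂ * (h / 2) := by ring
      _ ≤ _ := by gcongr)
  simp only [neg_neg, neg_sub, sub_neg_eq_add] at h2
  rw [add_comm (s • τ) x] at h2
  have hin : y - s • τ - (x + s • τ) ∈ futureCausal B τ := by
    have := hB.sub_smul_mem hτ (s := 2 * s) hc hxy (by linarith)
    convert this using 1
    module
  have hleft : x + s • τ - x' ∈ futureCausal B τ := by
    have := hAw (x - x') s hs0 (by rw [hs]; gcongr)
    rwa [sub_add_eq_add_sub] at this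
  have hright : y' - (y - s • τ) ∈ futureCausal B τ := by
    have := hAw (y' - y) s hs0 (by rw [hs]; gcongr)
    convert this using 1
    abel
  have h3 := hd.add_le _ _ _ hleft hin
  have hleft' : y - s • τ - x' ∈ futureCausal B τ := by
    have := hB.add_mem hτ hleft hin
    rwa [sub_add_sub_cancel'] at this
  have h4 := hd.add_le _ _ _ hleft' hright
  have h5 := hd.nonneg hm hleft
  have h6 := hd.nonneg hm hright
  have h7 : (K₁ + K₂) * A * ρ = K₁ * s + K₂ * s := by rw [hs]; ring
  linarith

theorem IsTimeSep.exists_lipschitzOnWith (hd : IsTimeSep B τ Γ m M κ d) (hm : 0 < m) (hM : 0 < M)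
    (hκ : 0 ≤ κ) (hB : IsLorentzian B) (hτ : B τ τ < 0) [DiscreteTopology Γ] [IsZLattice ℝ Γ]
    {c : ℝ} (hc : 0 < c) :
    ∃ L : ℝ≥0, LipschitzOnWith L (fun p : V × V => d p.1 p.2)
      {p : V × V | p.2 - p.1 ∈ steep B τ c} := by
  obtain ⟨L, δ, hL, hδ, hloc⟩ := hd.exists_local_bound hm hM hκ hB hτ hc
  refine ⟨L.toNNReal, LipschitzOnWith.of_dist_le_mul fun p hp q hq => ?_⟩
  rw [Real.coe_toNNReal L hL]
  -- Convexity keeps the whole segment steep with height at least `h₀`, so the local radius is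
  -- bounded below along it.
  set h₀ := min (height B τ (p.2 - p.1)) (height B τ (q.2 - q.1)) with hh₀
  have hh₀0 : 0 < h₀ := lt_min (height_pos hp.1) (height_pos hq.1)
  have hconv : Convex ℝ (steep B τ c ∩ {v | h₀ ≤ height B τ v}) := by
    refine (hB.convex_steep hτ c).inter fun u hu v hv a b ha hb hab => ?_
    change h₀ ≤ _
    rw [height_add, height_smul, height_smul]
    calc h₀ = a * h₀ + b * h₀ := by rw [← add_mul, hab, one_mul]
      _ ≤ _ := add_le_add (mul_le_mul_of_nonneg_left hu ha) (mul_le_mul_of_nonneg_left hv hb)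
  -- The number of steps depends on `p` and `q`, but the losses `L * dist p q / n` add up to `L *
  -- dist p q`.
  obtain ⟨n, hn⟩ := exists_nat_gt (dist p q / (δ * min 1 h₀))
  have hmin : 0 < δ * min 1 h₀ := by positivity
  have hn0 : (0 : ℝ) < n := (div_nonneg dist_nonneg hmin.le).trans_lt hn
  rw [div_lt_iff₀ hmin] at hn
  let P : ℕ → V × V := fun i => AffineMap.lineMap p q ((i : ℝ) / n)
  have hP0 : P 0 = p := by simp [P]
  have hPn : P n = q := by simp [P, hn0.ne']
  have hmem : ∀ i ≤ n, (P i).2 - (P i).1 ∈ steep B τ c ∩ {v | h₀ ≤ height B τ v} := by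
    intro i hi
    have h1 := hconv.lineMap_mem (x := p.2 - p.1) (y := q.2 - q.1) ⟨hp, (min_le_left _ _ : h₀ ≤ _)⟩
      ⟨hq, (min_le_right _ _ : h₀ ≤ _)⟩ (t := (i : ℝ) / n)
      ⟨by positivity, div_le_one_of_le₀ (by exact_mod_cast hi) hn0.le⟩
    convert h1 using 1
    simp only [P, AffineMap.lineMap_apply_module, Prod.fst_add, Prod.snd_add, Prod.smul_fst,
      Prod.smul_snd]
    module
  have hdist : ∀ i, ‖P (i + 1) - P i‖ = dist p q / n := by
    intro i
    rw [← dist_eq_norm, dist_lineMap_lineMap, Real.dist_eq]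
    have : ((i + 1 : ℕ) : ℝ) / n - i / n = 1 / n := by push_cast; ring
    rw [this, abs_of_pos (by positivity)]
    ring
  have hsmall : dist p q / n ≤ δ * min 1 h₀ := by
    rw [div_le_iff₀ hn0]
    linarith
  have hone : ∀ i j, i ≤ n → ‖P j - P i‖ = dist p q / n →
      d (P i).1 (P i).2 - L * (dist p q / n) ≤ d (P j).1 (P j).2 := by
    intro i j hi hij
    rw [← hij]
    rw [← hij] at hsmall
    refine hloc _ _ (hmem i hi).1 (hsmall.trans ?_) (hsmall.trans ?_)
    · exact mul_le_of_le_one_right hδ.le (min_le_left _ _)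
    · exact mul_le_mul_of_nonneg_left ((min_le_right _ _).trans (hmem i hi).2) hδ.le
  have hsum := dist_le_range_sum_of_dist_le (f := fun i => d (P i).1 (P i).2) n
    (d := fun _ => L * (dist p q / n)) fun {i} hi => by
      have h1 := hone i (i + 1) hi.le (hdist i)
      have h2 := hone (i + 1) i hi (by rw [norm_sub_rev]; exact hdist i)
      rw [Real.dist_eq, abs_le]
      constructor <;> linarith
  rw [hP0, hPn, Finset.sum_const, Finset.card_range, nsmul_eq_mul] at hsum
  refine hsum.trans_eq ?_
  field_simp

end FiniteDimensional

end LorentzTorus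

/-! ### Main theorem. -/

theorem theorem2p3 {V : Type*} [NormedAddCommGroup V] [NormedSpace ℝ V] [FiniteDimensional ℝ V]
    (B : LinearMap.BilinForm ℝ V) (hB : LorentzTorus.IsLorentzian B)
    (τ : V) (hτ : B τ τ < 0)
    (Γ : Submodule ℤ V) [DiscreteTopology Γ] [IsZLattice ℝ Γ]
    (f : V → ℝ) (hf : ContDiff ℝ ∞ f) (hfpos : ∀ x, 0 < f x)
    (hfΓ : ∀ k ∈ Γ, ∀ x, f (x + k) = f x)
    (ε : ℝ) (hε : 0 < ε) :
    ∃ L : ℝ≥0,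
      (∀ x y : V, y - x ∈ LorentzTorus.futureCausalEps B τ ε →
        LorentzTorus.timeSeparation (LorentzTorus.conformalMetric f B) τ x y ≠ ⊤) ∧
      LipschitzOnWith L
        (fun p : V × V =>
          (LorentzTorus.timeSeparation (LorentzTorus.conformalMetric f B) τ p.1 p.2).toReal)
        {p : V × V | p.2 - p.1 ∈ LorentzTorus.futureCausalEps B τ ε} := by
  obtain ⟨C, hC, hnorm⟩ := hB.exists_norm_le hτ
  obtain ⟨m, hm, hfm⟩ := LorentzTorus.exists_lower_bound_of_periodic hf.continuous hfpos hfΓ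
  obtain ⟨M, hM, hfM'⟩ := LorentzTorus.exists_bounds_of_periodic hf.continuous hfΓ
  obtain ⟨K, hK, hfK⟩ := LorentzTorus.exists_lipschitz_of_periodic hf hfΓ
  obtain ⟨c, hc, hsub⟩ := hB.exists_futureCausalEps_subset hτ hε
  have hfM : ∀ x, f x ≤ M := fun x => (le_abs_self _).trans (hfM' x)
  have hfin := LorentzTorus.timeSeparation_ne_top hB hτ hfpos hfM
  have hd := LorentzTorus.isTimeSep_timeSeparation hB hτ hfΓ hm hfm hfM hK hfK hC hnorm hfin
  obtain ⟨L, hL⟩ := hd.exists_lipschitzOnWith hm hM (by positivity) hB hτ hc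
  exact ⟨L, fun x y _ => hfin x y, hL.mono fun p hp => hsub hp⟩
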